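/- Let $A\in\mathbb R^{m\times n}$, $b=A\bar x+z\in\mathbb R^m$, $\bar S=\mathrm{supp}(\bar x)$, $\bar s=|\bar S|$. Let $f(x)=\frac12\|Ax-b\|_2^2$, $\phi_\lambda(x)=f(x)+\lambda\|x\|_1$, $\phi_\lambda^\star=\min_x\phi_\lambda(x)$, $\omega_\lambda(x)=\min_{\xi\in\partial\|x\|_1}\|\nabla f(x)+\lambda\xi\|_\infty$, $\psi_{\lambda,L}(y;x)=f(y)+\nabla f(y)^T(x-y)+\frac L2\|x-y\|_2^2+\lambda\|x\|_1$ and $T_{\lambda,L}(y)=\arg\min_x\psi_{\lambda,L}(y;x)$. For an integer $s$ let $\rho_+(A,s)$ and $\rho_-(A,s)$ be the supremum and the infimum of $x^TA^TAx/x^Tx$ over all $x\ne0$ with at most $s$ nonzero entries. **Algorithms.** Fix $\gamma_{\rm inc}>1$, $\gamma_{\rm dec}\ge1$, $L_{\min}>0$. $\mathtt{LineSearch}(\lambda,x,L)$ computes $x^+=T_{\lambda,L}(x)$ and, as long as $\phi_\lambda(x^+)>\psi_{\lambda,L}(x;x^+)$, replaces $L$ by $\gamma_{\rm inc}L$ and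 recomputes $x^+$; it returns $x^+$ and the final value $M$ of $L$. $\mathtt{ProxGrad}(\lambda,\hat\epsilon,x^{(0)},L_0)$ performs, for $k=0,1,2,\dots$, the proximal-gradient step $\{x^{(k+1)},M_k\}=\mathtt{LineSearch}(\lambda,x^{(k)},L_k)$ and sets $L_{k+1}=\max\{L_{\min},M_k/\gamma_{\rm dec}\}$, until $\omega_\lambda(x^{(k+1)})\le\hat\epsilon$; it returns the last $x^{(k+1)}$ and $M_k$. The homotopy method, with parameters $\lambda_{\rm tgt}>0$, $\epsilon>0$, $\eta,\delta\in(0,1)$, sets $\lambda_0=\|A^Tb\|_\infty$, $\lambda_K=\eta^K\lambda_0$, $\hat x^{(0)}=0$, $\hat M_0=L_{\min}$, $N=\lfloor\ln(\lambda_0/\lambda_{\rm tgt})/\ln\eta^{-1}\rfloor$, then computes $\{\hat x^{(K+1)},\hat M_{K+1}\}=\mathtt{ProxGrad}(\lambda_{K+1},\delta\lambda_{K+1},\hat x^{(K)},\hat M_K)$ for $K=0,\dots,N-1$, and finally $\{\hat x^{(\rm tgt)},\hat M_{\rm tgt}\}=\mathtt{ProxGrad}(\lambda_{\rm tgt},\epsilon,\hat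 x^{(N)},\hat M_N)$. **Assumptions.** Let $\delta'\in(0,1)$, $\gamma>(1+\delta')/(1-\delta')$ and the integer $\tilde s\ge 0$ satisfy $$\lambda_{\rm tgt}\ge\max\Big\{4,\tfrac{\gamma+1}{(1-\delta')\gamma-(1+\delta')}\Big\}\|A^Tz\|_\infty,\qquad \rho_-(A,\bar s+2\tilde s)>0,$$ $$\tilde s>\frac{16\big(\gamma_{\rm inc}\rho_+(A,\bar s+2\tilde s)+2\rho_+(A,\tilde s)\big)}{\rho_-(A,\bar s+\tilde s)}(1+\gamma)\bar s,\qquad L_{\min}\le\gamma_{\rm inc}\rho_+(A,\bar s+2\tilde s).$$ Let moreover $\lambda_{\rm tgt}\le\lambda_0$ and $\frac{1+\delta}{1+\delta'}\le\eta<1$. Put $\kappa=\rho_+(A,\bar s+2\tilde s)/\rho_-(A,\bar s+2\tilde s)$ and $C=8\gamma_{\rm inc}(1+\kappa)^2(1+\gamma)\kappa\bar s$. **Theorem.** The homotopy method terminates, and the following hold. 1. In each call of $\mathtt{ProxGrad}$, made with parameter $\lambda$ (that is, $\lambda=\lambda_{K+1}$ with $K<N$, or $\lambda=\lambda_{\rm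 tgt}$) and starting point $x^{(0)}$, we have $\|x^{(0)}_{\bar S^c}\|_0\le\tilde s$ and $\omega_\lambda(x^{(0)})\le\delta'\lambda$. For $K=0,\dots,N-1$ the number of proximal-gradient steps in the call that produces $\hat x^{(K+1)}$ is at most $$\ln\Big(\frac C{\delta^2}\Big)\Big/\ln\Big(1-\frac1{4\gamma_{\rm inc}\kappa}\Big)^{-1}.$$ 2. For $K=0,\dots,N-1$, $$\phi_{\lambda_{\rm tgt}}(\hat x^{(K)})-\phi^\star_{\lambda_{\rm tgt}}\le\eta^{2(K+1)}\,\frac{4.5(1+\gamma)\lambda_0^2\bar s}{\rho_-(A,\bar s+\tilde s)},\qquad \|\hat x^{(K)}-\bar x\|_2\le\eta^{K+1}\,\frac{2\lambda_0\sqrt{\bar s}}{\rho_-(A,\bar s+\tilde s)}.$$ 3. The total number of proximal-gradient steps is at most the larger of $1$ and $$\left(\frac{\ln(\lambda_0/\lambda_{\rm tgt})}{\ln\eta^{-1}}\ln\Big(\frac C{\delta^2}\Big)+\ln\max\Big(1,\frac{\lambda_{\rm tgt}^2C}{\epsilon^2}\Big)\right)\Big/\ln\Big(1-\frac1{4\gamma_{\rm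 inc}\kappa}\Big)^{-1},$$ and the output satisfies $$\phi_{\lambda_{\rm tgt}}(\hat x^{(\rm tgt)})-\phi^\star_{\lambda_{\rm tgt}}\le\frac{4(1+\gamma)\lambda_{\rm tgt}\bar s}{\rho_-(A,\bar s+\tilde s)}\,\epsilon .$$ -/

import Mathlib

open scoped Matrix

namespace PGH

variable {m n : ℕ}

/-! ### Vectors: support, norms -/

/-- The support `{j | x j ≠ 0}` of a vector; `‖x‖₀` is its cardinality. -/
noncomputable def supp (x : Fin n → ℝ) : Finset (Fin n) :=
  Finset.univ.filter (fun j => x j ≠ 0)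

/-- The number `‖x‖₀` of nonzero entries. -/
noncomputable def l0 (x : Fin n → ℝ) : ℕ := (supp x).card

/-- The number `‖x_{Sᶜ}‖₀` of nonzero entries of `x` at coordinates outside `S`. -/
noncomputable def l0Off (S : Finset (Fin n)) (x : Fin n → ℝ) : ℕ := (supp x \ S).card

/-- The `ℓ₁` norm. -/
def l1 (x : Fin n → ℝ) : ℝ := ∑ i, |x i|

/-- The Euclidean norm. -/
noncomputable def l2 (x : Fin n → ℝ) : ℝ := √(∑ i, x i ^ 2)

/-- The `ℓ_∞` norm: the norm that Mathlib puts on `Fin n → ℝ` is the sup norm. -/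
noncomputable def linf (x : Fin n → ℝ) : ℝ := ‖x‖

/-! ### Restricted eigenvalues -/

/-- The set of Rayleigh quotients `xᵀ Aᵀ A x / xᵀ x` over the nonzero `x` with `‖x‖₀ ≤ s`. -/
def rayleighSet (A : Matrix (Fin m) (Fin n) ℝ) (s : ℕ) : Set ℝ :=
  {r | ∃ x : Fin n → ℝ, x ≠ 0 ∧ l0 x ≤ s ∧ r = (x ⬝ᵥ ((Aᵀ * A) *ᵥ x)) / (x ⬝ᵥ x)}

/-- The restricted eigenvalue `ρ₊(A, s)`. -/
noncomputable def rhoPlus (A : Matrix (Fin m) (Fin n) ℝ) (s : ℕ) : ℝ := sSup (rayleighSet A s)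

/-- The restricted eigenvalue `ρ₋(A, s)`. -/
noncomputable def rhoMinus (A : Matrix (Fin m) (Fin n) ℝ) (s : ℕ) : ℝ := sInf (rayleighSet A s)

/-- The restricted condition number `κ(A, s) = ρ₊(A, s) / ρ₋(A, s)`. -/
noncomputable def kappa (A : Matrix (Fin m) (Fin n) ℝ) (s : ℕ) : ℝ := rhoPlus A s / rhoMinus A s

/-! ### The `ℓ₁`-regularized least-squares problem -/

/-- The least-squares term `f(x) = ½ ‖A x - b‖₂²`. -/
noncomputable def f (A : Matrix (Fin m) (Fin n) ℝ) (b : Fin m → ℝ) (x : Fin n → ℝ) : ℝ :=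
  1 / 2 * l2 (A *ᵥ x - b) ^ 2

/-- The gradient `∇f(x) = Aᵀ (A x - b)`. -/
def gradf (A : Matrix (Fin m) (Fin n) ℝ) (b : Fin m → ℝ) (x : Fin n → ℝ) : Fin n → ℝ :=
  Aᵀ *ᵥ (A *ᵥ x - b)

/-- The objective `φ_lam(x) = f(x) + lam ‖x‖₁`. -/
noncomputable def phi (A : Matrix (Fin m) (Fin n) ℝ) (b : Fin m → ℝ) (lam : ℝ)
    (x : Fin n → ℝ) : ℝ :=
  f A b x + lam * l1 x

/-- The optimal value `φ_lam^⋆ = min_x φ_lam(x)`. -/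
noncomputable def phiStar (A : Matrix (Fin m) (Fin n) ℝ) (b : Fin m → ℝ) (lam : ℝ) : ℝ :=
  ⨅ x : Fin n → ℝ, phi A b lam x

/-- The subdifferential of the `ℓ₁` norm at `x`. -/
def subdiffL1 (x : Fin n → ℝ) : Set (Fin n → ℝ) :=
  {ξ | ∀ y : Fin n → ℝ, l1 x + ξ ⬝ᵥ (y - x) ≤ l1 y}

/-- The optimality residue `ω_lam(x) = min_{ξ ∈ ∂‖x‖₁} ‖∇f(x) + lam ξ‖_∞`. -/
noncomputable def omega (A : Matrix (Fin m) (Fin n) ℝ) (b : Fin m → ℝ) (lam : ℝ)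
    (x : Fin n → ℝ) : ℝ :=
  sInf ((fun ξ => linf (gradf A b x + lam • ξ)) '' subdiffL1 x)

/-- The local model
`ψ_{lam,L}(y; x) = f(y) + ∇f(y)ᵀ (x - y) + (L / 2) ‖x - y‖₂² + lam ‖x‖₁`. -/
noncomputable def psi (A : Matrix (Fin m) (Fin n) ℝ) (b : Fin m → ℝ) (lam L : ℝ)
    (y x : Fin n → ℝ) : ℝ :=
  f A b y + gradf A b y ⬝ᵥ (x - y) + L / 2 * l2 (x - y) ^ 2 + lam * l1 x

/-- `x = T_{lam,L}(y)`: the point `x` minimizes `ψ_{lam,L}(y; ·)`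
(for `L > 0` there is exactly one such point). -/
def IsProxPoint (A : Matrix (Fin m) (Fin n) ℝ) (b : Fin m → ℝ) (lam L : ℝ)
    (y x : Fin n → ℝ) : Prop :=
  ∀ w : Fin n → ℝ, psi A b lam L y x ≤ psi A b lam L y w

/-! ### The algorithms

Each algorithm is given by its terminating executions: the relation holds between the inputs and
the outputs of the executions that halt. -/

/-- `LineSearch A b γinc lam x L x' M`: the line search started at `x` with the estimate `L`
halts and returns `{x', M}`. -/
inductive LineSearch (A : Matrix (Fin m) (Fin n) ℝ) (b : Fin m → ℝ) (γinc lam : ℝ)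
    (x : Fin n → ℝ) : ℝ → (Fin n → ℝ) → ℝ → Prop
  | accept (L : ℝ) (x' : Fin n → ℝ) :
      IsProxPoint A b lam L x x' → phi A b lam x' ≤ psi A b lam L x x' →
      LineSearch A b γinc lam x L x' L
  | reject (L : ℝ) (w x' : Fin n → ℝ) (M : ℝ) :
      IsProxPoint A b lam L x w → psi A b lam L x w < phi A b lam w →
      LineSearch A b γinc lam x (L * γinc) x' M →
      LineSearch A b γinc lam x L x' M

/-- `ProxGrad A b γinc γdec Lmin lam tol x L xhat Mhat k`: the proximal gradient method with
tolerance `tol`, started at the point `x` with the estimate `L`, halts after exactly `k` iterations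
(proximal-gradient steps `x⁽ⁱ⁾ ↦ x⁽ⁱ⁺¹⁾`) and returns `{xhat, Mhat}`. -/
inductive ProxGrad (A : Matrix (Fin m) (Fin n) ℝ) (b : Fin m → ℝ) (γinc γdec Lmin lam tol : ℝ) :
    (Fin n → ℝ) → ℝ → (Fin n → ℝ) → ℝ → ℕ → Prop
  | last (x : Fin n → ℝ) (L : ℝ) (x' : Fin n → ℝ) (M : ℝ) :
      LineSearch A b γinc lam x L x' M → omega A b lam x' ≤ tol →
      ProxGrad A b γinc γdec Lmin lam tol x L x' M 1
  | next (x : Fin n → ℝ) (L : ℝ) (x' : Fin n → ℝ) (M : ℝ) (xhat : Fin n → ℝ) (Mhat : ℝ) (k : ℕ) :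
      LineSearch A b γinc lam x L x' M → tol < omega A b lam x' →
      ProxGrad A b γinc γdec Lmin lam tol x' (max Lmin (M / γdec)) xhat Mhat k →
      ProxGrad A b γinc γdec Lmin lam tol x L xhat Mhat (k + 1)

/-- `lam_0 = ‖Aᵀ b‖_∞`. -/
noncomputable def lam0 (A : Matrix (Fin m) (Fin n) ℝ) (b : Fin m → ℝ) : ℝ := linf (Aᵀ *ᵥ b)

/-- `lam_K = η^K lam_0`. -/
noncomputable def lamSeq (A : Matrix (Fin m) (Fin n) ℝ) (b : Fin m → ℝ) (η : ℝ) (K : ℕ) : ℝ :=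
  η ^ K * lam0 A b

/-- The number `N = ⌊ln (lam_0 / lam_tgt) / ln (1 / η)⌋` of intermediate stages. -/
noncomputable def numStages (A : Matrix (Fin m) (Fin n) ℝ) (b : Fin m → ℝ) (η lamTgt : ℝ) : ℕ :=
  ⌊Real.log (lam0 A b / lamTgt) / Real.log (1 / η)⌋₊

/-- A complete execution of the proximal-gradient homotopy method. For `K < N`, the call that
turns `xhat K` into `xhat (K + 1)` takes `steps K` proximal-gradient steps; the final call, for
`lam_tgt`, takes `stepsTgt` steps and returns `xtgt`. (The values of `xhat`, `Mhat` beyond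
index `N` and those of `steps` from index `N` on play no role.) -/
structure HomotopyRun (A : Matrix (Fin m) (Fin n) ℝ) (b : Fin m → ℝ)
    (γinc γdec Lmin η δ lamTgt ε : ℝ)
    (xhat : ℕ → Fin n → ℝ) (Mhat : ℕ → ℝ) (steps : ℕ → ℕ)
    (xtgt : Fin n → ℝ) (Mtgt : ℝ) (stepsTgt : ℕ) : Prop where
  init_x : xhat 0 = 0
  init_M : Mhat 0 = Lmin
  stage : ∀ K < numStages A b η lamTgt,
    ProxGrad A b γinc γdec Lmin (lamSeq A b η (K + 1)) (δ * lamSeq A b η (K + 1))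
      (xhat K) (Mhat K) (xhat (K + 1)) (Mhat (K + 1)) (steps K)
  final : ProxGrad A b γinc γdec Lmin lamTgt ε
    (xhat (numStages A b η lamTgt)) (Mhat (numStages A b η lamTgt)) xtgt Mtgt stepsTgt

/-! ### The standing assumption -/

/-- The assumption on the sparse recovery problem `b = A xbar + z`, with `S̄ = supp xbar` and
`s̄ = |S̄| = l0 xbar`. -/
structure RecoveryAssumption (A : Matrix (Fin m) (Fin n) ℝ) (b : Fin m → ℝ)
    (xbar : Fin n → ℝ) (z : Fin m → ℝ) (lamTgt γ δ' : ℝ) (st : ℕ) (γinc Lmin : ℝ) : Prop where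
  model : b = A *ᵥ xbar + z
  delta_pos : 0 < δ'
  delta_lt_one : δ' < 1
  gamma_pos : 0 < γ
  gamma_gt : (1 + δ') / (1 - δ') < γ
  big_lam : max 4 ((γ + 1) / ((1 - δ') * γ - (1 + δ'))) * linf (Aᵀ *ᵥ z) ≤ lamTgt
  rho_pos : 0 < rhoMinus A (l0 xbar + 2 * st)
  sparsity : 16 * (γinc * rhoPlus A (l0 xbar + 2 * st) + 2 * rhoPlus A st)
      / rhoMinus A (l0 xbar + st) * (1 + γ) * (l0 xbar : ℝ) < (st : ℝ)
  Lmin_le : Lmin ≤ γinc * rhoPlus A (l0 xbar + 2 * st)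

/-- The condition on the starting point `x` of the proximal gradient method with regularization
parameter `lam`: `‖x_{S̄ᶜ}‖₀ ≤ s̃` and `ω_lam(x) ≤ δ' lam`. -/
def GoodStart (A : Matrix (Fin m) (Fin n) ℝ) (b : Fin m → ℝ) (xbar : Fin n → ℝ) (δ' : ℝ)
    (st : ℕ) (lam : ℝ) (x : Fin n → ℝ) : Prop :=
  l0Off (supp xbar) x ≤ st ∧ omega A b lam x ≤ δ' * lam

/-- The constant `C = 8 γinc (1 + κ)² (1 + γ) κ s̄`. -/
noncomputable def constC (γinc κ γ s : ℝ) : ℝ := 8 * γinc * (1 + κ) ^ 2 * (1 + γ) * κ * s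

end PGH

/-! Restricted to vectors with at most `st` nonzeros off the support of `xbar`, the least-squares
term is smooth and strongly convex with condition number `κ`, because differences of two such
vectors have at most `l0 xbar + 2 * st` nonzeros. Everything rests on never leaving this sparse set,
and that in turn on staying in a sublevel set near `xbar`.

Fix `lam ≥ lamTgt` and put `q = s̄ / ρ₋(A, s̄ + s̃)`. A sparse point with residue at most `δ' lam`
satisfies a cone inequality (`residue_ineq`) that puts it within `ℓ₁` distance `(1 + γ) / 2 * lam *
q` of `xbar`; by convexity it lies in `SparseLevel`. Points of `SparseLevel` still have controlled
`ℓ₁` error and energy `‖A(x - xbar)‖²` (`level_bound`). A proximal step with estimate at most `γinc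
ρ₊` creates a nonzero off the support only where a large quantity beats the threshold `lam`, and
counting such coordinates gives at most `st` of them (`prox_sparse`). Accepted steps decrease the
objective, so `SparseLevel` is invariant, and the line search keeps its estimate below `γinc ρ₊`.
The same sparsity argument yields a sparse global minimizer.

Each step then contracts the objective gap by `1 - 1 / (4 γinc κ)`, and the squared residue after a
step is at most a constant times the gap before it (`LineSearch.stepProperties`). This bounds the
number of steps of a call by a logarithm.

Across stages, lowering `lam` to `lam'` raises the residue by at most `lam - lam'`. The condition on
`η` is exactly what turns residue `δ lam` into residue at most `δ' lam'`, so each output is a valid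
starting point for the next call. The zero vector, optimal at `lam_0`, starts the induction. -/

namespace PGH

variable {m n : ℕ}

/-! ### Norms and dot products -/

theorem l2_sq (x : Fin n → ℝ) : l2 x ^ 2 = x ⬝ᵥ x := by
  rw [l2, Real.sq_sqrt (Finset.sum_nonneg fun i _ => sq_nonneg _)]
  simp [dotProduct, sq]

theorem l2_nonneg (x : Fin n → ℝ) : 0 ≤ l2 x := Real.sqrt_nonneg _

theorem l1_nonneg (x : Fin n → ℝ) : 0 ≤ l1 x := Finset.sum_nonneg fun _ _ => abs_nonneg _

theorem dotProduct_self_nonneg' (x : Fin n → ℝ) : 0 ≤ x ⬝ᵥ x := by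
  rw [← l2_sq]; positivity

theorem dotProduct_sq_le (x y : Fin n → ℝ) : (x ⬝ᵥ y) ^ 2 ≤ (x ⬝ᵥ x) * (y ⬝ᵥ y) := by
  have h := Finset.sum_mul_sq_le_sq_mul_sq Finset.univ x y
  simpa only [dotProduct, sq] using h

theorem dotProduct_self_pos {x : Fin n → ℝ} (hx : x ≠ 0) : 0 < x ⬝ᵥ x :=
  lt_of_le_of_ne (dotProduct_self_nonneg' x) fun h => hx (dotProduct_self_eq_zero.1 h.symm)

theorem abs_le_linf (x : Fin n → ℝ) (i : Fin n) : |x i| ≤ linf x := by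
  have := norm_le_pi_norm x i
  rwa [Real.norm_eq_abs] at this

theorem linf_nonneg (x : Fin n → ℝ) : 0 ≤ linf x := norm_nonneg _

theorem linf_le {x : Fin n → ℝ} {c : ℝ} (hc : 0 ≤ c) (h : ∀ i, |x i| ≤ c) : linf x ≤ c :=
  (pi_norm_le_iff_of_nonneg hc).2 h

theorem linf_le_l1 (x : Fin n → ℝ) : linf x ≤ l1 x :=
  linf_le (l1_nonneg x) fun i =>
    Finset.single_le_sum (f := fun i => |x i|) (fun _ _ => abs_nonneg _) (Finset.mem_univ i)

theorem dotProduct_le_linf_mul_l1 (x y : Fin n → ℝ) : x ⬝ᵥ y ≤ linf x * l1 y := by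
  rw [l1, Finset.mul_sum]
  refine Finset.sum_le_sum fun i _ => (le_abs_self _).trans ?_
  rw [abs_mul]
  exact mul_le_mul_of_nonneg_right (abs_le_linf x i) (abs_nonneg _)

theorem l1_add_le (x y : Fin n → ℝ) : l1 (x + y) ≤ l1 x + l1 y := by
  rw [l1, l1, l1, ← Finset.sum_add_distrib]
  exact Finset.sum_le_sum fun i _ => abs_add_le _ _

theorem l1_smul (c : ℝ) (x : Fin n → ℝ) : l1 (c • x) = |c| * l1 x := by
  simp [l1, Finset.mul_sum, abs_mul]

theorem l1_sub_comm (x y : Fin n → ℝ) : l1 (x - y) = l1 (y - x) := by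
  simp only [l1, Pi.sub_apply, abs_sub_comm]

theorem l1_sub_le_add (x y w : Fin n → ℝ) : l1 (x - y) ≤ l1 (x - w) + l1 (y - w) := by
  have := l1_add_le (x - w) (w - y)
  rwa [sub_add_sub_cancel, l1_sub_comm w y] at this

theorem l1_segment_le (x y : Fin n → ℝ) {t : ℝ} (h0 : 0 ≤ t) (h1 : t ≤ 1) :
    l1 (x + t • (y - x)) ≤ l1 x + t * (l1 y - l1 x) := by
  have e : x + t • (y - x) = (1 - t) • x + t • y := by module
  have := l1_add_le ((1 - t) • x) (t • y)
  rw [l1_smul, l1_smul, abs_of_nonneg h0, abs_of_nonneg (sub_nonneg.2 h1)] at this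
  rw [e]; linarith

/-! ### The quadratic term -/

theorem dotProduct_gram (A : Matrix (Fin m) (Fin n) ℝ) (x y : Fin n → ℝ) :
    x ⬝ᵥ (Aᵀ *ᵥ (A *ᵥ y)) = (A *ᵥ x) ⬝ᵥ (A *ᵥ y) := by
  rw [Matrix.dotProduct_mulVec, Matrix.vecMul_transpose]

theorem f_add (A : Matrix (Fin m) (Fin n) ℝ) (b : Fin m → ℝ) (x d : Fin n → ℝ) :
    f A b (x + d) = f A b x + gradf A b x ⬝ᵥ d + 1 / 2 * ((A *ᵥ d) ⬝ᵥ (A *ᵥ d)) := by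
  have e : A *ᵥ (x + d) - b = (A *ᵥ x - b) + A *ᵥ d := by rw [Matrix.mulVec_add]; abel
  have e2 : gradf A b x ⬝ᵥ d = (A *ᵥ x - b) ⬝ᵥ (A *ᵥ d) := by
    rw [gradf, dotProduct_comm, Matrix.dotProduct_mulVec, Matrix.vecMul_transpose,
      dotProduct_comm]
  rw [f, f, l2_sq, l2_sq, e, e2, add_dotProduct, dotProduct_add, dotProduct_add,
    dotProduct_comm (A *ᵥ d) (A *ᵥ x - b)]
  ring

theorem f_eq (A : Matrix (Fin m) (Fin n) ℝ) (b : Fin m → ℝ) (x y : Fin n → ℝ) :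
    f A b y = f A b x + gradf A b x ⬝ᵥ (y - x)
      + 1 / 2 * ((A *ᵥ (y - x)) ⬝ᵥ (A *ᵥ (y - x))) := by
  rw [← f_add, add_sub_cancel]

theorem gradf_sub (A : Matrix (Fin m) (Fin n) ℝ) (b : Fin m → ℝ) (x y : Fin n → ℝ) :
    gradf A b x - gradf A b y = Aᵀ *ᵥ (A *ᵥ (x - y)) := by
  rw [gradf, gradf, ← Matrix.mulVec_sub, Matrix.mulVec_sub A]; congr 1; abel

theorem gradf_model {A : Matrix (Fin m) (Fin n) ℝ} {b z : Fin m → ℝ} {xbar : Fin n → ℝ}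
    (h : b = A *ᵥ xbar + z) (x : Fin n → ℝ) :
    gradf A b x = Aᵀ *ᵥ (A *ᵥ (x - xbar)) - Aᵀ *ᵥ z := by
  rw [gradf, ← Matrix.mulVec_sub, Matrix.mulVec_sub A, h]; congr 1; abel

theorem f_nonneg (A : Matrix (Fin m) (Fin n) ℝ) (b : Fin m → ℝ) (x : Fin n → ℝ) :
    0 ≤ f A b x := by unfold f; positivity

theorem continuous_mulVec_apply (A : Matrix (Fin m) (Fin n) ℝ) :
    Continuous fun x : Fin n → ℝ => A *ᵥ x := by
  fun_prop

theorem continuous_l1 : Continuous (l1 : (Fin n → ℝ) → ℝ) := by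
  unfold l1; fun_prop

theorem continuous_l2 : Continuous (l2 : (Fin n → ℝ) → ℝ) := by
  unfold l2; fun_prop

theorem continuous_phi (A : Matrix (Fin m) (Fin n) ℝ) (b : Fin m → ℝ) (lam : ℝ) :
    Continuous (phi A b lam) := by
  unfold phi f
  have := (continuous_l2 (n := m)).comp ((continuous_mulVec_apply A).sub (continuous_const (y := b)))
  exact (continuous_const.mul (this.pow 2)).add (continuous_const.mul continuous_l1)

theorem continuous_psi (A : Matrix (Fin m) (Fin n) ℝ) (b : Fin m → ℝ) (lam L : ℝ)
    (y : Fin n → ℝ) : Continuous (psi A b lam L y) := by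
  unfold psi
  have h1 := (continuous_l2 (n := n)).comp (continuous_id.sub (continuous_const (y := y)))
  have h2 : Continuous fun x : Fin n → ℝ => gradf A b y ⬝ᵥ (x - y) := by
    unfold dotProduct; fun_prop
  exact ((continuous_const.add h2).add (continuous_const.mul (h1.pow 2))).add
    (continuous_const.mul continuous_l1)

/-! ### Restricted eigenvalues -/

theorem mem_supp {x : Fin n → ℝ} {j : Fin n} : j ∈ supp x ↔ x j ≠ 0 := by simp [supp]

theorem rayleighSet_mono (A : Matrix (Fin m) (Fin n) ℝ) {s s' : ℕ} (h : s ≤ s') :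
    rayleighSet A s ⊆ rayleighSet A s' := by
  rintro r ⟨x, hx, hs, rfl⟩
  exact ⟨x, hx, hs.trans h, rfl⟩

theorem mulVec_dotProduct_self_le (A : Matrix (Fin m) (Fin n) ℝ) (x : Fin n → ℝ) :
    (A *ᵥ x) ⬝ᵥ (A *ᵥ x) ≤ (∑ i, A i ⬝ᵥ A i) * (x ⬝ᵥ x) := by
  rw [Finset.sum_mul, dotProduct]
  refine Finset.sum_le_sum fun i _ => ?_
  have := dotProduct_sq_le (A i) x
  rwa [sq] at this

theorem rayleigh_eq (A : Matrix (Fin m) (Fin n) ℝ) (x : Fin n → ℝ) :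
    x ⬝ᵥ ((Aᵀ * A) *ᵥ x) = (A *ᵥ x) ⬝ᵥ (A *ᵥ x) := by
  rw [← Matrix.mulVec_mulVec, dotProduct_gram]

theorem bddAbove_rayleighSet (A : Matrix (Fin m) (Fin n) ℝ) (s : ℕ) :
    BddAbove (rayleighSet A s) := by
  refine ⟨∑ i, A i ⬝ᵥ A i, ?_⟩
  rintro r ⟨x, hx, -, rfl⟩
  rw [div_le_iff₀ (dotProduct_self_pos hx), rayleigh_eq]
  exact mulVec_dotProduct_self_le A x

theorem rayleighSet_nonneg (A : Matrix (Fin m) (Fin n) ℝ) (s : ℕ) :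
    ∀ r ∈ rayleighSet A s, 0 ≤ r := by
  rintro r ⟨x, hx, -, rfl⟩
  rw [rayleigh_eq]
  exact div_nonneg (dotProduct_self_nonneg' _) (dotProduct_self_nonneg' _)

theorem bddBelow_rayleighSet (A : Matrix (Fin m) (Fin n) ℝ) (s : ℕ) :
    BddBelow (rayleighSet A s) := ⟨0, rayleighSet_nonneg A s⟩

theorem rhoPlus_nonneg (A : Matrix (Fin m) (Fin n) ℝ) (s : ℕ) : 0 ≤ rhoPlus A s :=
  Real.sSup_nonneg (rayleighSet_nonneg A s)

theorem le_rhoPlus_mul (A : Matrix (Fin m) (Fin n) ℝ) {s : ℕ} {x : Fin n → ℝ} (hx : l0 x ≤ s) :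
    (A *ᵥ x) ⬝ᵥ (A *ᵥ x) ≤ rhoPlus A s * (x ⬝ᵥ x) := by
  by_cases h : x = 0
  · simp [h]
  rw [← div_le_iff₀ (dotProduct_self_pos h)]
  exact le_csSup (bddAbove_rayleighSet A s) ⟨x, h, hx, by rw [rayleigh_eq]⟩

theorem rhoMinus_mul_le (A : Matrix (Fin m) (Fin n) ℝ) {s : ℕ} {x : Fin n → ℝ} (hx : l0 x ≤ s) :
    rhoMinus A s * (x ⬝ᵥ x) ≤ (A *ᵥ x) ⬝ᵥ (A *ᵥ x) := by
  by_cases h : x = 0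
  · simp [h]
  rw [← le_div_iff₀ (dotProduct_self_pos h)]
  exact csInf_le (bddBelow_rayleighSet A s) ⟨x, h, hx, by rw [rayleigh_eq]⟩

theorem rayleighSet_nonempty_of_rhoMinus_pos {A : Matrix (Fin m) (Fin n) ℝ} {s : ℕ}
    (h : 0 < rhoMinus A s) : (rayleighSet A s).Nonempty := by
  by_contra h0
  rw [Set.not_nonempty_iff_eq_empty] at h0
  rw [rhoMinus, h0, Real.sInf_empty] at h
  exact h.false

theorem l0_single_le (j : Fin n) (c : ℝ) : l0 (Pi.single j c) ≤ 1 := by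
  rw [l0, Finset.card_le_one]
  intro a ha b hb
  rw [mem_supp] at ha hb
  have : ∀ a, (Pi.single j c : Fin n → ℝ) a ≠ 0 → a = j := fun a h => by
    by_contra hne
    exact h (by simp [hne])
  rw [this a ha, this b hb]

/-- The infimum of the empty set of reals is `0`, so positivity of `rhoMinus` excludes the
degenerate cases in which there is no Rayleigh quotient. -/
theorem nonempty_and_pos_of_rhoMinus_pos {A : Matrix (Fin m) (Fin n) ℝ} {s : ℕ}
    (h : 0 < rhoMinus A s) : Nonempty (Fin n) ∧ 1 ≤ s := by
  obtain ⟨r, x, hx, hs, -⟩ := rayleighSet_nonempty_of_rhoMinus_pos h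
  obtain ⟨j, hj⟩ := Function.ne_iff.1 hx
  exact ⟨⟨j⟩, le_trans (Finset.card_pos.2 ⟨j, mem_supp.2 hj⟩) hs⟩

theorem rayleighSet_nonempty [Nonempty (Fin n)] (A : Matrix (Fin m) (Fin n) ℝ) {s : ℕ}
    (h : 1 ≤ s) : (rayleighSet A s).Nonempty := by
  obtain ⟨j⟩ := ‹Nonempty (Fin n)›
  exact ⟨_, Pi.single j 1, by simp, (l0_single_le j 1).trans h, rfl⟩

/-- The bound `1 ≤ s` matters: for `s = 0` the set is empty, `rhoMinus A 0 = 0`, and monotonicity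
can fail. -/
theorem rhoMinus_anti [Nonempty (Fin n)] (A : Matrix (Fin m) (Fin n) ℝ) {s s' : ℕ} (h1 : 1 ≤ s)
    (h : s ≤ s') : rhoMinus A s' ≤ rhoMinus A s :=
  csInf_le_csInf (bddBelow_rayleighSet A s') (rayleighSet_nonempty A h1) (rayleighSet_mono A h)

theorem rhoMinus_le_rhoPlus (A : Matrix (Fin m) (Fin n) ℝ) {s : ℕ} (h : 0 < rhoMinus A s) :
    rhoMinus A s ≤ rhoPlus A s :=
  csInf_le_csSup (rayleighSet_nonempty_of_rhoMinus_pos h) (bddBelow_rayleighSet A s)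
    (bddAbove_rayleighSet A s)

theorem gram_mulVec_apply (A : Matrix (Fin m) (Fin n) ℝ) (d : Fin n → ℝ) (j : Fin n) :
    (Aᵀ *ᵥ (A *ᵥ d)) j = (A *ᵥ Pi.single j 1) ⬝ᵥ (A *ᵥ d) := by
  rw [← dotProduct_gram, single_one_dotProduct]

/-- Cauchy–Schwarz for `A e_j` and `A d`, each of whose squared norms is controlled by the same
`rhoPlus A s`. -/
theorem abs_gram_mulVec_apply_le (A : Matrix (Fin m) (Fin n) ℝ) {s : ℕ} (hs : 1 ≤ s)
    {d : Fin n → ℝ} (hd : l0 d ≤ s) (j : Fin n) :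
    |(Aᵀ *ᵥ (A *ᵥ d)) j| ≤ rhoPlus A s * l2 d := by
  have h0 := rhoPlus_nonneg A s
  refine abs_le_of_sq_le_sq ?_ (mul_nonneg h0 (l2_nonneg d))
  rw [gram_mulVec_apply, mul_pow, l2_sq]
  have h1 := dotProduct_sq_le (A *ᵥ Pi.single j 1) (A *ᵥ d)
  have h2 := le_rhoPlus_mul A ((l0_single_le j 1).trans hs)
  have h3 := le_rhoPlus_mul A hd
  rw [single_one_dotProduct, Pi.single_eq_same, mul_one] at h2
  have h4 := mul_le_mul h2 h3 (dotProduct_self_nonneg' _) h0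
  linarith [h1, h4]

/-! ### Sparsity -/

theorem l0_sub_le (S : Finset (Fin n)) (x y : Fin n → ℝ) :
    l0 (x - y) ≤ S.card + (l0Off S x + l0Off S y) := by
  have : supp (x - y) ⊆ S ∪ ((supp x \ S) ∪ (supp y \ S)) := by
    intro j hj
    simp only [Finset.mem_union, Finset.mem_sdiff, mem_supp, Pi.sub_apply] at hj ⊢
    by_contra hc
    push Not at hc
    obtain ⟨h1, h2, h3⟩ := hc
    by_cases hx : x j = 0 <;> by_cases hy : y j = 0
    · simp [hx, hy] at hj
    · exact h1 (h3 hy)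
    · exact h1 (h2 hx)
    · exact h1 (h2 hx)
  exact (Finset.card_le_card this).trans ((Finset.card_union_le _ _).trans
    (Nat.add_le_add_left (Finset.card_union_le _ _) _))

theorem l0Off_supp_self (x : Fin n → ℝ) : l0Off (supp x) x = 0 := by simp [l0Off]

/-- The set is a finite union of coordinate subspaces, one for each admissible set `T` of extra
nonzeros. -/
theorem isClosed_l0Off_le (S : Finset (Fin n)) (s : ℕ) :
    IsClosed {x : Fin n → ℝ | l0Off S x ≤ s} := by
  have : {x : Fin n → ℝ | l0Off S x ≤ s} =
      ⋃ T ∈ {T : Finset (Fin n) | T.card ≤ s}, ⋂ j ∈ {j | j ∉ S ∪ T}, {x | x j = 0} := by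
    ext x
    simp only [Set.mem_ofPred_eq, Set.mem_iUnion, Set.mem_iInter, exists_prop]
    constructor
    · intro h
      refine ⟨supp x \ S, h, fun j hj => ?_⟩
      by_contra hne
      simp [mem_supp, hne] at hj
    · rintro ⟨T, hT, h⟩
      refine le_trans (Finset.card_le_card fun j hj => ?_) hT
      rw [Finset.mem_sdiff, mem_supp] at hj
      by_contra hjT
      exact hj.1 (h j (by simp [hj.2, hjT]))
  rw [this]
  refine Set.Finite.isClosed_biUnion (Set.toFinite _) fun T _ => ?_
  exact isClosed_biInter fun j _ => isClosed_eq (continuous_apply j) continuous_const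

/-! ### The subdifferential of the `ℓ₁` norm -/

theorem l1_single (j : Fin n) (c : ℝ) : l1 (Pi.single j c) = |c| := by
  rw [l1, Finset.sum_eq_single j] <;> simp +contextual

theorem dotProduct_single' (ξ : Fin n → ℝ) (j : Fin n) (c : ℝ) :
    ξ ⬝ᵥ (Pi.single j c) = ξ j * c := dotProduct_single ξ c j

theorem abs_le_one_of_mem_subdiffL1 {x ξ : Fin n → ℝ} (h : ξ ∈ subdiffL1 x) (j : Fin n) :
    |ξ j| ≤ 1 := by
  have key : ∀ c : ℝ, ξ j * c ≤ |c| := fun c => by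
    have h1 := h (x + Pi.single j c)
    have h2 := l1_add_le x (Pi.single j c)
    rw [add_sub_cancel_left, dotProduct_single'] at h1
    rw [l1_single] at h2
    linarith
  have h1 := key 1
  have h2 := key (-1)
  rw [abs_neg, abs_one] at h2
  rw [abs_one] at h1
  exact abs_le.2 ⟨by linarith, by linarith⟩

theorem l1_update_zero (x : Fin n → ℝ) (j : Fin n) :
    l1 (x + Pi.single j (-x j)) = l1 x - |x j| := by
  rw [l1, l1, ← Finset.add_sum_erase _ _ (Finset.mem_univ j),
    ← Finset.add_sum_erase _ (fun i => |x i|) (Finset.mem_univ j)]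
  have : ∑ i ∈ Finset.univ.erase j, |(x + Pi.single j (-x j) : Fin n → ℝ) i|
      = ∑ i ∈ Finset.univ.erase j, |x i| :=
    Finset.sum_congr rfl fun i hi => by simp [Finset.ne_of_mem_erase hi]
  rw [this]
  simp

/-- The subgradient inequality is tested at `x` with its `j`-th coordinate erased. -/
theorem abs_le_mul_of_mem_subdiffL1 {x ξ : Fin n → ℝ} (h : ξ ∈ subdiffL1 x) (j : Fin n) :
    |x j| ≤ ξ j * x j := by
  have h1 := h (x + Pi.single j (-x j))
  rw [l1_update_zero, add_sub_cancel_left, dotProduct_single'] at h1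
  linarith

theorem subdiffL1_nonempty (x : Fin n → ℝ) : (subdiffL1 x).Nonempty := by
  refine ⟨fun j => if 0 ≤ x j then 1 else -1, fun y => ?_⟩
  rw [l1, l1, dotProduct, ← Finset.sum_add_distrib]
  refine Finset.sum_le_sum fun j _ => ?_
  rw [Pi.sub_apply]
  split_ifs with h
  · rw [abs_of_nonneg h]; linarith [le_abs_self (y j)]
  · rw [abs_of_neg (not_le.1 h)]; linarith [neg_abs_le (y j)]

theorem isCompact_subdiffL1 (x : Fin n → ℝ) : IsCompact (subdiffL1 x) := by
  refine Metric.isCompact_of_isClosed_isBounded ?_ ?_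
  · have : subdiffL1 x = ⋂ y : Fin n → ℝ, {ξ | l1 x + ξ ⬝ᵥ (y - x) ≤ l1 y} := by
      ext ξ; simp [subdiffL1]
    rw [this]
    refine isClosed_iInter fun y => isClosed_le ?_ continuous_const
    unfold dotProduct
    fun_prop
  · refine (Metric.isBounded_closedBall (x := (0 : Fin n → ℝ)) (r := 1)).subset fun ξ hξ => ?_
    rw [mem_closedBall_zero_iff]
    exact linf_le zero_le_one (abs_le_one_of_mem_subdiffL1 hξ)

theorem exists_linf_eq_omega (A : Matrix (Fin m) (Fin n) ℝ) (b : Fin m → ℝ) (lam : ℝ)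
    (x : Fin n → ℝ) :
    ∃ ξ ∈ subdiffL1 x, linf (gradf A b x + lam • ξ) = omega A b lam x := by
  have hc : Continuous fun ξ : Fin n → ℝ => linf (gradf A b x + lam • ξ) := by
    unfold linf; fun_prop
  exact ((isCompact_subdiffL1 x).image hc).sInf_mem ((subdiffL1_nonempty x).image _)

theorem omega_le {A : Matrix (Fin m) (Fin n) ℝ} {b : Fin m → ℝ} {lam : ℝ} {x ξ : Fin n → ℝ}
    (h : ξ ∈ subdiffL1 x) : omega A b lam x ≤ linf (gradf A b x + lam • ξ) := by
  refine csInf_le ⟨0, ?_⟩ ⟨ξ, h, rfl⟩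
  rintro _ ⟨ξ, -, rfl⟩
  exact linf_nonneg _

theorem omega_nonneg (A : Matrix (Fin m) (Fin n) ℝ) (b : Fin m → ℝ) (lam : ℝ)
    (x : Fin n → ℝ) : 0 ≤ omega A b lam x := by
  obtain ⟨ξ, -, h⟩ := exists_linf_eq_omega A b lam x
  rw [← h]
  exact linf_nonneg _

/-- The subdifferential does not depend on `lam`, so the optimal `ξ` for `lam` is a candidate for
`lam'`, and its entries are at most `1` in absolute value. -/
theorem omega_le_omega_add (A : Matrix (Fin m) (Fin n) ℝ) (b : Fin m → ℝ) {lam lam' : ℝ}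
    (h : lam' ≤ lam) (x : Fin n → ℝ) : omega A b lam' x ≤ omega A b lam x + (lam - lam') := by
  obtain ⟨ξ, hξ, e⟩ := exists_linf_eq_omega A b lam x
  refine (omega_le hξ).trans ?_
  rw [← e]
  refine linf_le (add_nonneg (linf_nonneg _) (sub_nonneg.2 h)) fun j => ?_
  have h1 := abs_le_linf (gradf A b x + lam • ξ) j
  have h2 : (gradf A b x + lam' • ξ) j
      = (gradf A b x + lam • ξ) j - (lam - lam') * ξ j := by
    simp only [Pi.add_apply, Pi.smul_apply, smul_eq_mul]; ring
  have h3 := abs_sub ((gradf A b x + lam • ξ) j) ((lam - lam') * ξ j)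
  rw [abs_mul, abs_of_nonneg (sub_nonneg.2 h)] at h3
  have h4 := mul_le_mul_of_nonneg_left (abs_le_one_of_mem_subdiffL1 hξ j) (sub_nonneg.2 h)
  rw [h2]
  linarith

/-- Convexity of the objective, with a subgradient that attains the optimality residue. -/
theorem phi_sub_add_le (A : Matrix (Fin m) (Fin n) ℝ) (b : Fin m → ℝ) {lam : ℝ} (hl : 0 ≤ lam)
    (x y : Fin n → ℝ) : phi A b lam x - phi A b lam y
      + 1 / 2 * ((A *ᵥ (y - x)) ⬝ᵥ (A *ᵥ (y - x))) ≤ omega A b lam x * l1 (x - y) := by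
  obtain ⟨ξ, hξ, e⟩ := exists_linf_eq_omega A b lam x
  rw [← e]
  refine le_trans ?_ (dotProduct_le_linf_mul_l1 _ _)
  have h1 := f_eq A b x y
  have h2 := mul_le_mul_of_nonneg_left (hξ y) hl
  rw [← neg_sub y x, dotProduct_neg, add_dotProduct, smul_dotProduct, smul_eq_mul, phi, phi]
  linarith

theorem phi_sub_le (A : Matrix (Fin m) (Fin n) ℝ) (b : Fin m → ℝ) {lam : ℝ} (hl : 0 ≤ lam)
    (x y : Fin n → ℝ) : phi A b lam x - phi A b lam y ≤ omega A b lam x * l1 (x - y) := by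
  have h1 := phi_sub_add_le A b hl x y
  have h2 := dotProduct_self_nonneg' (A *ᵥ (y - x))
  linarith

/-- At `0` the gradient is `-Aᵀ b`, and `Aᵀ b / lam_0` has sup norm `1`, hence is a subgradient that
cancels it. -/
theorem omega_zero_le {A : Matrix (Fin m) (Fin n) ℝ} {b : Fin m → ℝ} (h : 0 < lam0 A b) :
    omega A b (lam0 A b) (0 : Fin n → ℝ) ≤ 0 := by
  have hξ : (lam0 A b)⁻¹ • (Aᵀ *ᵥ b) ∈ subdiffL1 (0 : Fin n → ℝ) := fun y => by
    have h1 := dotProduct_le_linf_mul_l1 (Aᵀ *ᵥ b) y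
    rw [sub_zero, smul_dotProduct, smul_eq_mul]
    have h2 : l1 (0 : Fin n → ℝ) = 0 := by simp [l1]
    rw [h2, zero_add, inv_mul_le_iff₀ h]
    exact h1
  refine (omega_le hξ).trans ?_
  rw [gradf, smul_inv_smul₀ h.ne', Matrix.mulVec_zero, zero_sub, Matrix.mulVec_neg,
    neg_add_cancel, linf, norm_zero]

/-! ### The proximal step -/

theorem psi_self (A : Matrix (Fin m) (Fin n) ℝ) (b : Fin m → ℝ) (lam L : ℝ) (x : Fin n → ℝ) :
    psi A b lam L x x = phi A b lam x := by
  simp [psi, phi, l2_sq]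

theorem phi_eq_psi_add (A : Matrix (Fin m) (Fin n) ℝ) (b : Fin m → ℝ) (lam L : ℝ)
    (x y : Fin n → ℝ) : phi A b lam y = psi A b lam L x y
      + (1 / 2 * ((A *ᵥ (y - x)) ⬝ᵥ (A *ᵥ (y - x))) - L / 2 * ((y - x) ⬝ᵥ (y - x))) := by
  rw [phi, psi, f_eq A b x y, l2_sq]; ring

theorem phi_ge_linf (A : Matrix (Fin m) (Fin n) ℝ) (b : Fin m → ℝ) {lam : ℝ} (hl : 0 ≤ lam)
    (x : Fin n → ℝ) : lam * ‖x‖ ≤ phi A b lam x := by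
  have h1 := f_nonneg A b x
  have h2 := mul_le_mul_of_nonneg_left (linf_le_l1 x) hl
  rw [linf] at h2
  rw [phi]; linarith

/-- Completing the square absorbs the linear term. The resulting coercivity makes the proximal point
exist. -/
theorem psi_ge_linf (A : Matrix (Fin m) (Fin n) ℝ) (b : Fin m → ℝ) {lam L : ℝ} (hl : 0 ≤ lam)
    (hL : 0 < L) (x w : Fin n → ℝ) :
    lam * ‖w‖ + (f A b x - (gradf A b x ⬝ᵥ gradf A b x) / (2 * L)) ≤ psi A b lam L x w := by
  have h2 := mul_le_mul_of_nonneg_left (linf_le_l1 w) hl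
  rw [linf] at h2
  have h3 := dotProduct_self_nonneg' (gradf A b x + L • (w - x))
  rw [add_dotProduct, dotProduct_add, dotProduct_add, dotProduct_smul, smul_dotProduct,
    smul_dotProduct, dotProduct_smul, dotProduct_comm (w - x) (gradf A b x)] at h3
  simp only [smul_eq_mul] at h3
  rw [psi, l2_sq]
  have h4 : (gradf A b x ⬝ᵥ gradf A b x) / (2 * L) + gradf A b x ⬝ᵥ (w - x)
      + L / 2 * ((w - x) ⬝ᵥ (w - x))
      = (gradf A b x ⬝ᵥ gradf A b x + L * (gradf A b x ⬝ᵥ (w - x))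
        + (L * (gradf A b x ⬝ᵥ (w - x)) + L * (L * ((w - x) ⬝ᵥ (w - x))))) / (2 * L) := by
    field_simp; ring
  have h5 := div_nonneg h3 (by linarith : 0 ≤ 2 * L)
  linarith

theorem exists_isProxPoint (A : Matrix (Fin m) (Fin n) ℝ) (b : Fin m → ℝ) {lam L : ℝ}
    (hl : 0 < lam) (hL : 0 < L) (x : Fin n → ℝ) : ∃ x', IsProxPoint A b lam L x x' := by
  refine (continuous_psi A b lam L x).exists_forall_le ?_
  refine Filter.tendsto_atTop_mono (psi_ge_linf A b hl.le hL x) ?_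
  exact Filter.tendsto_atTop_add_const_right _ _
    ((tendsto_norm_cocompact_atTop).const_mul_atTop hl)

theorem nonneg_of_forall_mul_add_sq_nonneg {a c : ℝ}
    (h : ∀ t : ℝ, 0 < t → t ≤ 1 → 0 ≤ t * a + t ^ 2 * c) : 0 ≤ a := by
  by_contra ha
  push Not at ha
  have hc : 0 < |c| + 1 - a := by linarith [abs_nonneg c]
  -- If `a < 0`, this `t ≤ 1` gives `a + t * |c| = -t * (1 - a) < 0`, contradicting the hypothesis.
  have ht : 0 < -a / (|c| + 1 - a) := div_pos (by linarith) hc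
  have ht1 : -a / (|c| + 1 - a) ≤ 1 := (div_le_one hc).2 (by linarith [abs_nonneg c])
  have h1 := h _ ht ht1
  set t := -a / (|c| + 1 - a) with htdef
  have h2 : t * (|c| + 1 - a) = -a := div_mul_cancel₀ _ hc.ne'
  have h3 : 0 ≤ a + t * c := by
    by_contra h4
    push Not at h4
    nlinarith
  have h5 : t * c ≤ t * |c| := mul_le_mul_of_nonneg_left (le_abs_self c) ht.le
  nlinarith

/-- The optimality condition of the proximal step. -/
theorem IsProxPoint.mem_subdiffL1 {A : Matrix (Fin m) (Fin n) ℝ} {b : Fin m → ℝ} {lam L : ℝ}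
    (hl : 0 < lam) {x x' : Fin n → ℝ} (h : IsProxPoint A b lam L x x') :
    -(lam⁻¹ • (gradf A b x + L • (x' - x))) ∈ subdiffL1 x' := by
  intro y
  have key : 0 ≤ (gradf A b x + L • (x' - x)) ⬝ᵥ (y - x') + lam * (l1 y - l1 x') := by
    refine nonneg_of_forall_mul_add_sq_nonneg (c := L / 2 * ((y - x') ⬝ᵥ (y - x')))
      fun t h0 h1 => ?_
    have h2 := h (x' + t • (y - x'))
    have h3 := mul_le_mul_of_nonneg_left (l1_segment_le x' y h0.le h1) hl.le
    have e : x' + t • (y - x') - x = (x' - x) + t • (y - x') := by abel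
    rw [psi, psi, e, l2_sq, l2_sq] at h2
    simp only [add_dotProduct, dotProduct_add, dotProduct_smul, smul_dotProduct,
      smul_eq_mul, dotProduct_comm (y - x') (x' - x)] at h2 ⊢
    nlinarith
  rw [neg_dotProduct, smul_dotProduct, smul_eq_mul]
  have h1 : lam * (lam⁻¹ * ((gradf A b x + L • (x' - x)) ⬝ᵥ (y - x')))
      = (gradf A b x + L • (x' - x)) ⬝ᵥ (y - x') := mul_inv_cancel_left₀ hl.ne' _
  refine le_of_mul_le_mul_left ?_ hl
  linarith

/-- Strong convexity of the local model. -/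
theorem IsProxPoint.psi_add_le {A : Matrix (Fin m) (Fin n) ℝ} {b : Fin m → ℝ} {lam L : ℝ}
    (hl : 0 < lam) {x x' : Fin n → ℝ} (h : IsProxPoint A b lam L x x') (w : Fin n → ℝ) :
    psi A b lam L x x' + L / 2 * ((w - x') ⬝ᵥ (w - x')) ≤ psi A b lam L x w := by
  have h1 := mul_le_mul_of_nonneg_left (h.mem_subdiffL1 hl w) hl.le
  rw [neg_dotProduct, smul_dotProduct, smul_eq_mul, mul_add, mul_neg,
    mul_inv_cancel_left₀ hl.ne'] at h1
  have e : w - x = (x' - x) + (w - x') := by abel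
  rw [psi, psi, l2_sq, l2_sq, e]
  simp only [add_dotProduct, dotProduct_add, smul_dotProduct,
      smul_eq_mul, dotProduct_comm (w - x') (x' - x)] at h1 ⊢
  linarith

/-- The residue after a proximal step is at most the change of the gradient mapping. -/
theorem IsProxPoint.omega_le {A : Matrix (Fin m) (Fin n) ℝ} {b : Fin m → ℝ} {lam L : ℝ}
    (hl : 0 < lam) {x x' : Fin n → ℝ} (h : IsProxPoint A b lam L x x') :
    omega A b lam x' ≤ linf (Aᵀ *ᵥ (A *ᵥ (x' - x)) - L • (x' - x)) := by
  refine (PGH.omega_le (h.mem_subdiffL1 hl)).trans (le_of_eq ?_)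
  rw [← gradf_sub A b, smul_neg, smul_inv_smul₀ hl.ne']
  congr 1; abel

/-! ### Error bounds for sparse approximate solutions -/

/-- The `ℓ₁` norm of the restriction `x_S`. -/
def l1On (S : Finset (Fin n)) (x : Fin n → ℝ) : ℝ := ∑ j ∈ S, |x j|

theorem l1On_nonneg (S : Finset (Fin n)) (x : Fin n → ℝ) : 0 ≤ l1On S x :=
  Finset.sum_nonneg fun _ _ => abs_nonneg _

theorem l1_eq_l1On_add (S : Finset (Fin n)) (x : Fin n → ℝ) : l1 x = l1On S x + l1On Sᶜ x :=
  (Finset.sum_add_sum_compl S _).symm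

/-- Off its support `xbar` vanishes, so the error there is `x` itself; on the support the triangle
inequality applies. This is the source of the cone inequality. -/
theorem l1On_compl_sub_le (xbar x : Fin n → ℝ) :
    l1On (supp xbar)ᶜ (x - xbar) - l1On (supp xbar) (x - xbar) ≤ l1 x - l1 xbar := by
  rw [l1_eq_l1On_add (supp xbar) x, l1_eq_l1On_add (supp xbar) xbar]
  have h1 : l1On (supp xbar)ᶜ (x - xbar) = l1On (supp xbar)ᶜ x :=
    Finset.sum_congr rfl fun j hj => by
      have : xbar j = 0 := by simpa [mem_supp] using hj
      simp [this]
  have h2 : l1On (supp xbar)ᶜ xbar = 0 :=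
    Finset.sum_eq_zero fun j hj => by simpa [mem_supp] using hj
  have h3 : l1On (supp xbar) xbar ≤ l1On (supp xbar) x + l1On (supp xbar) (x - xbar) := by
    rw [l1On, l1On, l1On, ← Finset.sum_add_distrib]
    refine Finset.sum_le_sum fun j _ => ?_
    have := abs_sub (x j) ((x - xbar) j)
    rwa [Pi.sub_apply, sub_sub_cancel] at this
  linarith

theorem l1On_sq_le (S : Finset (Fin n)) (x : Fin n → ℝ) :
    l1On S x ^ 2 ≤ (S.card : ℝ) * (x ⬝ᵥ x) := by
  refine (sq_sum_le_card_mul_sum_sq).trans (mul_le_mul_of_nonneg_left ?_ (Nat.cast_nonneg _))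
  rw [← l2_sq, l2, Real.sq_sqrt (Finset.sum_nonneg fun i _ => sq_nonneg _)]
  simp only [sq_abs]
  exact Finset.sum_le_sum_of_subset_of_nonneg (Finset.subset_univ _) fun _ _ _ => sq_nonneg _

/-- Here `p` and `t` are the `ℓ₁` masses of the error on and off the support, `a` is its energy, `h`
bounds residue plus noise, and `q = s̄ / ρ₋`. AM–GM gives `2 lam p - a ≤ lam² q`, and `hh` says that
`lam - h` is at least `2 lam / (γ + 1)`. -/
theorem cone_l1_bound {p t a h lam γ q : ℝ} (hq : 0 < q) (hp : 0 ≤ p) (ht : 0 ≤ t)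
    (hpa : p ^ 2 ≤ q * a) (hb : a + lam * (t - p) ≤ h * (p + t)) (hl : 0 < lam) (hγ : 1 < γ)
    (hh : h * (γ + 1) ≤ lam * (γ - 1)) : p + t ≤ (1 + γ) / 2 * lam * q := by
  have h1 : 2 * lam * p - a ≤ lam ^ 2 * q := by
    refine le_of_mul_le_mul_left ?_ hq
    nlinarith [sq_nonneg (p - lam * q)]
  have h2 : (lam - h) * (p + t) ≤ lam ^ 2 * q := by linarith
  have h3 : 2 * lam * (p + t) ≤ (γ + 1) * (lam - h) * (p + t) :=
    mul_le_mul_of_nonneg_right (by linarith) (by linarith)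
  have h4 := mul_le_mul_of_nonneg_left h2 (by linarith : 0 ≤ γ + 1)
  refine le_of_mul_le_mul_left ?_ (by linarith : 0 < 2 * lam)
  linarith

/-- Since `h ≤ lam`, the off-support mass `t` cancels. -/
theorem cone_energy_bound {p t a h lam γ : ℝ} (hp : 0 ≤ p) (ht : 0 ≤ t)
    (hb : a + lam * (t - p) ≤ h * (p + t)) (hl : 0 < lam) (hγ : 1 < γ)
    (hh : h * (γ + 1) ≤ lam * (γ - 1)) : a ≤ 2 * lam * p := by
  have h1 : h ≤ lam := by
    refine le_of_mul_le_mul_right ?_ (by linarith : 0 < γ + 1)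
    linarith
  have := mul_le_mul_of_nonneg_right h1 (by linarith : 0 ≤ p + t)
  linarith

theorem level_energy_bound {p t a lam γ q : ℝ} (hq : 0 < q) (ht : 0 ≤ t)
    (hpa : p ^ 2 ≤ q * a) (hl : 0 < lam) (hγ : 1 < γ)
    (hb : 1 / 2 * a + lam * (t - p) - lam / 4 * (p + t) ≤ (1 + γ) / 2 * lam ^ 2 * q) :
    a ≤ 8 * (1 + γ) * lam ^ 2 * q ∧ p + t ≤ 8 / 3 * (1 + γ) * lam * q := by
  have hlq : 0 < lam ^ 2 * q := by positivity
  have h0 : 0 < (γ - 1) * (lam ^ 2 * q) := mul_pos (by linarith) hlq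
  -- Collecting terms in `hb`, `p` enters with coefficient `-5/4 lam`. This weight of AM–GM spends
  -- half of the available `a / 2`, leaving `a / 4` for the energy bound.
  have h1 : 5 * lam * p ≤ a + 25 / 4 * (lam ^ 2 * q) := by
    refine le_of_mul_le_mul_left ?_ hq
    nlinarith [sq_nonneg (p - 5 / 2 * (lam * q))]
  -- For the bound on `p + t` all of `a / 2` is spent, against `2 lam p`.
  have h2 : 4 * lam * p ≤ a + 4 * (lam ^ 2 * q) := by
    refine le_of_mul_le_mul_left ?_ hq
    nlinarith [sq_nonneg (p - 2 * (lam * q))]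
  have h3 : 0 ≤ lam * t := by positivity
  constructor
  · linarith
  · refine le_of_mul_le_mul_left ?_ hl
    linarith

section Recovery

variable {A : Matrix (Fin m) (Fin n) ℝ} {b : Fin m → ℝ} {xbar : Fin n → ℝ} {z : Fin m → ℝ}
  {lamTgt γ δ' γinc Lmin lam : ℝ} {st : ℕ}

namespace RecoveryAssumption

theorem one_lt_gamma (hA : RecoveryAssumption A b xbar z lamTgt γ δ' st γinc Lmin) : 1 < γ := by
  refine lt_trans ?_ hA.gamma_gt
  rw [lt_div_iff₀ (by linarith [hA.delta_lt_one])]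
  linarith [hA.delta_pos]

theorem noise_le (hA : RecoveryAssumption A b xbar z lamTgt γ δ' st γinc Lmin)
    (hl : lamTgt ≤ lam) : linf (Aᵀ *ᵥ z) ≤ lam / 4 := by
  have := mul_le_mul_of_nonneg_right (le_max_left 4 ((γ + 1) / ((1 - δ') * γ - (1 + δ'))))
    (linf_nonneg (Aᵀ *ᵥ z))
  linarith [hA.big_lam]

/-- The second entry of the maximum in `big_lam` is chosen for this: with it the two contributions
add up to exactly `lam * (γ - 1)`. -/
theorem residue_noise_le (hA : RecoveryAssumption A b xbar z lamTgt γ δ' st γinc Lmin)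
    (hl : lamTgt ≤ lam) : (δ' * lam + linf (Aᵀ *ᵥ z)) * (γ + 1) ≤ lam * (γ - 1) := by
  have h1 := mul_le_mul_of_nonneg_right (le_max_right 4 ((γ + 1) / ((1 - δ') * γ - (1 + δ'))))
    (linf_nonneg (Aᵀ *ᵥ z))
  have hd : 0 < (1 - δ') * γ - (1 + δ') := by
    have := hA.gamma_gt
    rw [div_lt_iff₀ (by linarith [hA.delta_lt_one])] at this
    linarith
  have h2 := h1.trans (hA.big_lam.trans hl)
  rw [div_mul_eq_mul_div, div_le_iff₀ hd] at h2
  linarith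

theorem nonempty (hA : RecoveryAssumption A b xbar z lamTgt γ δ' st γinc Lmin) :
    Nonempty (Fin n) := (nonempty_and_pos_of_rhoMinus_pos hA.rho_pos).1

theorem one_le_card (hA : RecoveryAssumption A b xbar z lamTgt γ δ' st γinc Lmin) :
    1 ≤ l0 xbar + 2 * st := (nonempty_and_pos_of_rhoMinus_pos hA.rho_pos).2

theorem rhoMinus_le (hA : RecoveryAssumption A b xbar z lamTgt γ δ' st γinc Lmin) :
    rhoMinus A (l0 xbar + 2 * st) ≤ rhoMinus A (l0 xbar + st) := by
  have := hA.nonempty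
  have := hA.one_le_card
  exact rhoMinus_anti A (by omega) (by omega)

theorem rho_pos' (hA : RecoveryAssumption A b xbar z lamTgt γ δ' st γinc Lmin) :
    0 < rhoMinus A (l0 xbar + st) := hA.rho_pos.trans_le hA.rhoMinus_le

theorem l0_sub_le (x : Fin n → ℝ) (hx : l0Off (supp xbar) x ≤ st) :
    l0 (x - xbar) ≤ l0 xbar + st := by
  have := PGH.l0_sub_le (supp xbar) x xbar
  rw [l0Off_supp_self] at this
  exact this.trans (Nat.add_le_add_left hx _)

theorem l1On_sq_le (hA : RecoveryAssumption A b xbar z lamTgt γ δ' st γinc Lmin)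
    {x : Fin n → ℝ} (hx : l0Off (supp xbar) x ≤ st) :
    l1On (supp xbar) (x - xbar) ^ 2 ≤ (l0 xbar : ℝ) / rhoMinus A (l0 xbar + st)
      * ((A *ᵥ (x - xbar)) ⬝ᵥ (A *ᵥ (x - xbar))) := by
  refine (PGH.l1On_sq_le _ _).trans ?_
  rw [div_mul_eq_mul_div, le_div_iff₀ hA.rho_pos', mul_assoc]
  refine mul_le_mul_of_nonneg_left ?_ (Nat.cast_nonneg _)
  rw [mul_comm]
  exact rhoMinus_mul_le A (l0_sub_le x hx)

/-- The subgradient attaining the residue is paired with `x - xbar`. As `∇f(x) = AᵀA(x - xbar) -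
Aᵀz`, this produces the energy, a noise term, and the change in `ℓ₁` norm. -/
theorem residue_ineq (hA : RecoveryAssumption A b xbar z lamTgt γ δ' st γinc Lmin)
    (hl : 0 ≤ lam) {c : ℝ} {x : Fin n → ℝ} (hx : omega A b lam x ≤ c) :
    (A *ᵥ (x - xbar)) ⬝ᵥ (A *ᵥ (x - xbar))
      + lam * (l1On (supp xbar)ᶜ (x - xbar) - l1On (supp xbar) (x - xbar))
      ≤ (c + linf (Aᵀ *ᵥ z)) *
        (l1On (supp xbar) (x - xbar) + l1On (supp xbar)ᶜ (x - xbar)) := by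
  rw [← l1_eq_l1On_add]
  obtain ⟨ξ, hξ, e⟩ := exists_linf_eq_omega A b lam x
  have h1 := dotProduct_le_linf_mul_l1 (gradf A b x + lam • ξ) (x - xbar)
  rw [e, gradf_model hA.model, add_dotProduct, sub_dotProduct, smul_dotProduct, smul_eq_mul,
    dotProduct_comm, dotProduct_gram] at h1
  have h2 := dotProduct_le_linf_mul_l1 (Aᵀ *ᵥ z) (x - xbar)
  have h3 := mul_le_mul_of_nonneg_left (hξ xbar) hl
  rw [← neg_sub x xbar, dotProduct_neg] at h3
  have h4 := mul_le_mul_of_nonneg_left (l1On_compl_sub_le xbar x) hl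
  have h5 := mul_le_mul_of_nonneg_right hx (l1_nonneg (x - xbar))
  linarith

variable (hs : 0 < l0 xbar) (ht : 0 < lamTgt)
include hs ht

theorem l1_sub_le (hA : RecoveryAssumption A b xbar z lamTgt γ δ' st γinc Lmin)
    (hl : lamTgt ≤ lam) {x : Fin n → ℝ} (hx : GoodStart A b xbar δ' st lam x) :
    l1 (x - xbar) ≤ (1 + γ) / 2 * lam * ((l0 xbar : ℝ) / rhoMinus A (l0 xbar + st)) := by
  rw [l1_eq_l1On_add (supp xbar)]
  exact cone_l1_bound (div_pos (Nat.cast_pos.2 hs) hA.rho_pos') (l1On_nonneg _ _)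
    (l1On_nonneg _ _) (hA.l1On_sq_le hx.1) (hA.residue_ineq (ht.le.trans hl) hx.2)
    (ht.trans_le hl) hA.one_lt_gamma (hA.residue_noise_le hl)

omit hs in
-- With `d = x - xbar`, the chain `ρ₋ ‖d‖² ≤ ‖A d‖² ≤ 2 lam ‖d_S̄‖₁ ≤ 2 lam √s̄ ‖d‖` is divided by
-- `‖d‖`.
theorem l2_sub_le (hA : RecoveryAssumption A b xbar z lamTgt γ δ' st γinc Lmin)
    (hl : lamTgt ≤ lam) {x : Fin n → ℝ} (hx : GoodStart A b xbar δ' st lam x) :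
    l2 (x - xbar) ≤ 2 * lam * √(l0 xbar : ℝ) / rhoMinus A (l0 xbar + st) := by
  have h1 := cone_energy_bound (l1On_nonneg _ _)
    (l1On_nonneg _ _) (hA.residue_ineq (ht.le.trans hl) hx.2)
    (ht.trans_le hl) hA.one_lt_gamma (hA.residue_noise_le hl)
  have h2 := rhoMinus_mul_le A (l0_sub_le x hx.1)
  have h3 : l1On (supp xbar) (x - xbar) ≤ √(l0 xbar : ℝ) * l2 (x - xbar) := by
    refine abs_le_of_sq_le_sq' ?_ (mul_nonneg (Real.sqrt_nonneg _) (l2_nonneg _)) |>.2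
    rw [mul_pow, Real.sq_sqrt (Nat.cast_nonneg _), l2_sq]
    exact PGH.l1On_sq_le _ _
  rw [← l2_sq] at h2
  rw [le_div_iff₀ hA.rho_pos']
  have h4 := l2_nonneg (x - xbar)
  have hlam := ht.trans_le hl
  rcases h4.eq_or_lt with h5 | h5
  · rw [← h5, zero_mul]; positivity
  · refine le_of_mul_le_mul_left ?_ h5
    have := mul_le_mul_of_nonneg_left h3 (by linarith : 0 ≤ 2 * lam)
    linarith

end RecoveryAssumption

/-- The sparse points of a sublevel set, in which the iterates remain. -/
def SparseLevel (A : Matrix (Fin m) (Fin n) ℝ) (b : Fin m → ℝ) (xbar : Fin n → ℝ) (γ : ℝ)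
    (st : ℕ) (lam : ℝ) (x : Fin n → ℝ) : Prop :=
  l0Off (supp xbar) x ≤ st ∧ phi A b lam x ≤ phi A b lam xbar
    + (1 + γ) / 2 * lam ^ 2 * ((l0 xbar : ℝ) / rhoMinus A (l0 xbar + st))

namespace RecoveryAssumption

variable (hs : 0 < l0 xbar) (ht : 0 < lamTgt)
include hs ht

/-- By convexity the gap to `xbar` is at most residue times `ℓ₁` distance, hence at most `lam * ((1
+ γ) / 2 * lam * q)`. This is the slack allowed in `SparseLevel`. -/
theorem sparseLevel (hA : RecoveryAssumption A b xbar z lamTgt γ δ' st γinc Lmin)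
    (hl : lamTgt ≤ lam) {x : Fin n → ℝ} (hx : GoodStart A b xbar δ' st lam x) :
    SparseLevel A b xbar γ st lam x := by
  refine ⟨hx.1, ?_⟩
  have hlam := ht.trans_le hl
  have h1 := phi_sub_le A b hlam.le x xbar
  have h2 := hA.l1_sub_le hs ht hl hx
  have h3 : omega A b lam x ≤ lam := hx.2.trans (by nlinarith [hA.delta_lt_one])
  have h4 := mul_le_mul h3 h2 (l1_nonneg _) hlam.le
  linarith

/-- Iterates need not have small residue, so only the level is used: `f` is expanded at `xbar`,
where the gradient is `-Aᵀz`, of size at most `lam / 4`. -/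
theorem level_bound (hA : RecoveryAssumption A b xbar z lamTgt γ δ' st γinc Lmin)
    (hl : lamTgt ≤ lam) {x : Fin n → ℝ} (hx : SparseLevel A b xbar γ st lam x) :
    (A *ᵥ (x - xbar)) ⬝ᵥ (A *ᵥ (x - xbar))
        ≤ 8 * (1 + γ) * lam ^ 2 * ((l0 xbar : ℝ) / rhoMinus A (l0 xbar + st)) ∧
      l1 (x - xbar) ≤ 8 / 3 * (1 + γ) * lam * ((l0 xbar : ℝ) / rhoMinus A (l0 xbar + st)) := by
  rw [l1_eq_l1On_add (supp xbar)]
  have hlam := ht.trans_le hl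
  refine level_energy_bound (div_pos (Nat.cast_pos.2 hs) hA.rho_pos')
    (l1On_nonneg _ _) (hA.l1On_sq_le hx.1) hlam hA.one_lt_gamma ?_
  have h1 := hx.2
  rw [phi, phi, f_eq A b xbar x, gradf_model hA.model, sub_self, Matrix.mulVec_zero,
    Matrix.mulVec_zero, zero_sub, neg_dotProduct] at h1
  have h2 := dotProduct_le_linf_mul_l1 (Aᵀ *ᵥ z) (x - xbar)
  have h3 := mul_le_mul_of_nonneg_right (hA.noise_le hl) (l1_nonneg (x - xbar))
  have h4 := mul_le_mul_of_nonneg_left (l1On_compl_sub_le xbar x) hlam.le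
  rw [← l1_eq_l1On_add]
  linarith

end RecoveryAssumption

/-! ### Sparsity of proximal points -/

theorem card_mul_sq_le_rhoPlus (A : Matrix (Fin m) (Fin n) ℝ) (u : Fin n → ℝ) {c : ℝ}
    (hc : 0 ≤ c) {s : ℕ} (T : Finset (Fin n)) (hT : T.card ≤ s)
    (h : ∀ j ∈ T, c ≤ |(Aᵀ *ᵥ (A *ᵥ u)) j|) :
    (T.card : ℝ) * c ^ 2 ≤ rhoPlus A s * ((A *ᵥ u) ⬝ᵥ (A *ᵥ u)) := by
  rcases T.eq_empty_or_nonempty with rfl | hne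
  · simpa using mul_nonneg (rhoPlus_nonneg A s) (dotProduct_self_nonneg' (A *ᵥ u))
  have hpos : (0 : ℝ) < T.card := Nat.cast_pos.2 hne.card_pos
  set w := Aᵀ *ᵥ (A *ᵥ u) with hw
  -- The sign pattern of `w` on `T`: it has squared norm `|T|` and pairs with `w` to at least `|T|
  -- c`. Cauchy–Schwarz then costs one factor `|T|`.
  let v : Fin n → ℝ := fun j => if j ∈ T then (if 0 ≤ w j then 1 else -1) else 0
  have hv0 : l0 v ≤ s := by
    refine le_trans (Finset.card_le_card fun j hj => ?_) hT
    by_contra hn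
    exact mem_supp.1 hj (by simp [v, hn])
  have hvv : v ⬝ᵥ v = T.card := by
    have : ∀ j, v j * v j = if j ∈ T then 1 else 0 := fun j => by
      by_cases hj : j ∈ T <;> by_cases hj' : 0 ≤ w j <;> simp [v, hj, hj']
    simp [dotProduct, this]
  have hvw : v ⬝ᵥ w = ∑ j ∈ T, |w j| := by
    rw [dotProduct, ← Finset.sum_subset (Finset.subset_univ T)
      fun j _ hj => by simp [v, hj]]
    refine Finset.sum_congr rfl fun j hj => ?_
    by_cases hj' : 0 ≤ w j
    · simp [v, hj, hj', abs_of_nonneg]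
    · simp [v, hj, hj', abs_of_neg (not_le.1 hj')]
  have h1 : (T.card : ℝ) * c ≤ (A *ᵥ v) ⬝ᵥ (A *ᵥ u) := by
    rw [← dotProduct_gram, ← hw, hvw, ← nsmul_eq_mul]
    exact Finset.card_nsmul_le_sum _ _ _ h
  have h2 := dotProduct_sq_le (A *ᵥ v) (A *ᵥ u)
  have h3 := le_rhoPlus_mul A hv0
  rw [hvv] at h3
  have h4 := mul_le_mul_of_nonneg_right h3 (dotProduct_self_nonneg' (A *ᵥ u))
  have h5 : ((T.card : ℝ) * c) ^ 2 ≤ ((A *ᵥ v) ⬝ᵥ (A *ᵥ u)) ^ 2 :=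
    pow_le_pow_left₀ (by positivity) h1 2
  refine le_of_mul_le_mul_left ?_ hpos
  linarith

/-- A nonzero coordinate of the proximal point comes from a large coordinate of the
gradient step. -/
theorem IsProxPoint.le_abs {lam L : ℝ} (hl : 0 < lam) (hL : 0 ≤ L) {x x' : Fin n → ℝ}
    (h : IsProxPoint A b lam L x x') {j : Fin n} (hj : x' j ≠ 0) :
    lam ≤ |gradf A b x j - L * x j| := by
  have h1 := abs_le_mul_of_mem_subdiffL1 (h.mem_subdiffL1 hl) j
  simp only [Pi.neg_apply, Pi.smul_apply, Pi.add_apply, Pi.sub_apply, smul_eq_mul] at h1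
  have h2 : lam * |x' j| ≤ -(gradf A b x j + L * (x' j - x j)) * x' j := by
    have := mul_le_mul_of_nonneg_left h1 hl.le
    rwa [← mul_assoc, mul_neg, mul_inv_cancel_left₀ hl.ne'] at this
  have h3 : 0 < |x' j| := abs_pos.2 hj
  refine le_of_mul_le_mul_right ?_ h3
  rw [← abs_mul]
  refine le_trans ?_ (neg_le_abs _)
  nlinarith [mul_nonneg hL (mul_self_nonneg (x' j))]

/-- A new nonzero at `j` off the support needs `lam ≤ |w_j - (Aᵀz)_j - L x_j|`. The noise takes at
most `lam / 4`, so `L |x_j| ≥ lam / 4` (the set `T1`, counted by the `ℓ₁` bound) or `|w_j| ≥ lam /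
2` (the set `T2`, counted by the energy bound). The sparsity assumption is calibrated to the sum of
the two counts. -/
theorem RecoveryAssumption.prox_sparse
    (hA : RecoveryAssumption A b xbar z lamTgt γ δ' st γinc Lmin)
    (hs : 0 < l0 xbar) (ht : 0 < lamTgt)
    (hl : lamTgt ≤ lam) {x x' : Fin n → ℝ} (hx : SparseLevel A b xbar γ st lam x) {L : ℝ}
    (hL : 0 < L) (hLle : L ≤ γinc * rhoPlus A (l0 xbar + 2 * st))
    (h : IsProxPoint A b lam L x x') : l0Off (supp xbar) x' ≤ st := by
  have hlam := ht.trans_le hl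
  obtain ⟨hen, hl1⟩ := hA.level_bound hs ht hl hx
  have hsp := hA.sparsity
  have hγ := hA.one_lt_gamma
  have hq : 0 < (l0 xbar : ℝ) / rhoMinus A (l0 xbar + st) :=
    div_pos (Nat.cast_pos.2 hs) hA.rho_pos'
  have hsp' : 16 * (γinc * rhoPlus A (l0 xbar + 2 * st) + 2 * rhoPlus A st) * (1 + γ)
      * ((l0 xbar : ℝ) / rhoMinus A (l0 xbar + st)) < st := by
    refine lt_of_eq_of_lt ?_ hsp
    ring
  set q := (l0 xbar : ℝ) / rhoMinus A (l0 xbar + st)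
  set P := rhoPlus A (l0 xbar + 2 * st)
  have hP' := rhoPlus_nonneg A st
  have hLq : L * ((1 + γ) * q) ≤ γinc * P * ((1 + γ) * q) :=
    mul_le_mul_of_nonneg_right hLle (by positivity)
  have hLq0 : 0 < L * ((1 + γ) * q) := by positivity
  set w := Aᵀ *ᵥ (A *ᵥ (x - xbar)) with hw
  let T1 := (supp xbar)ᶜ.filter fun j => lam / 4 ≤ L * |(x - xbar) j|
  let T2 := Finset.univ.filter fun j => lam / 2 ≤ |w j|
  have hT : supp x' \ supp xbar ⊆ T1 ∪ T2 := by
    intro j hj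
    rw [Finset.mem_sdiff, mem_supp] at hj
    have hb : xbar j = 0 := by simpa [mem_supp] using hj.2
    have h1 := h.le_abs hlam hL.le hj.1
    rw [gradf_model hA.model, Pi.sub_apply, ← hw] at h1
    have h2 := abs_sub (w j - (Aᵀ *ᵥ z) j) (L * x j)
    have h3 := abs_sub (w j) ((Aᵀ *ᵥ z) j)
    have h4 := (abs_le_linf (Aᵀ *ᵥ z) j).trans (hA.noise_le hl)
    rw [abs_mul, abs_of_pos hL] at h2
    simp only [T1, T2, Finset.mem_union, Finset.mem_filter, Finset.mem_compl, Finset.mem_univ,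
      true_and, hj.2, not_false_eq_true, Pi.sub_apply, hb, sub_zero]
    by_contra hc
    push Not at hc
    linarith [hc.1, hc.2]
  have hT1 : (T1.card : ℝ) ≤ 32 / 3 * (L * ((1 + γ) * q)) := by
    have h1 : (T1.card : ℝ) * (lam / 4) ≤ L * l1 (x - xbar) := by
      rw [← nsmul_eq_mul, l1, Finset.mul_sum]
      refine (Finset.card_nsmul_le_sum T1 (fun j => L * |(x - xbar) j|) _ fun j hj =>
        (Finset.mem_filter.1 hj).2).trans ?_
      exact Finset.sum_le_sum_of_subset_of_nonneg (Finset.subset_univ _) fun _ _ _ =>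
        mul_nonneg hL.le (abs_nonneg _)
    have h2 := mul_le_mul_of_nonneg_left hl1 hL.le
    refine le_of_mul_le_mul_right ?_ hlam
    linarith
  have hT2 : ∀ T ⊆ T2, T.card ≤ st → (T.card : ℝ) ≤ 32 * (rhoPlus A st * ((1 + γ) * q)) := by
    intro T hTT hTc
    have h1 := card_mul_sq_le_rhoPlus A (x - xbar) (by positivity : 0 ≤ lam / 2) T hTc
      fun j hj => (Finset.mem_filter.1 (hTT hj)).2
    have h2 := mul_le_mul_of_nonneg_left hen hP'
    refine le_of_mul_le_mul_right ?_ (by positivity : 0 < lam ^ 2)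
    linarith
  -- `rhoPlus A st` only controls subsets of size at most `st`. If `T2` were larger, a subset of
  -- size exactly `st` would already violate the strict bound `hsp'`.
  have hT2c : T2.card ≤ st := by
    by_contra hc
    obtain ⟨T, hTT, hTc⟩ := Finset.exists_subset_card_eq (not_le.1 hc).le
    have := hT2 T hTT hTc.le
    rw [hTc] at this
    linarith
  have h1 := hT2 T2 subset_rfl hT2c
  have h2 : (l0Off (supp xbar) x' : ℝ) ≤ T1.card + T2.card := by
    exact_mod_cast (Finset.card_le_card hT).trans (Finset.card_union_le _ _)
  have h3 : (l0Off (supp xbar) x' : ℝ) ≤ st := by linarith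
  exact_mod_cast h3

end Recovery

/-! ### The proximal gradient method on sparse vectors -/

section ProxGradAnalysis

variable {A : Matrix (Fin m) (Fin n) ℝ} {b : Fin m → ℝ} {xbar : Fin n → ℝ} {z : Fin m → ℝ}
  {lamTgt γ δ' γinc γdec Lmin lam : ℝ} {st : ℕ}

namespace RecoveryAssumption

theorem rhoPlus_pos (hA : RecoveryAssumption A b xbar z lamTgt γ δ' st γinc Lmin) :
    0 < rhoPlus A (l0 xbar + 2 * st) :=
  hA.rho_pos.trans_le (rhoMinus_le_rhoPlus A hA.rho_pos)

theorem one_le_kappa (hA : RecoveryAssumption A b xbar z lamTgt γ δ' st γinc Lmin) :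
    1 ≤ kappa A (l0 xbar + 2 * st) :=
  (one_le_div hA.rho_pos).2 (rhoMinus_le_rhoPlus A hA.rho_pos)

theorem kappa_mul (hA : RecoveryAssumption A b xbar z lamTgt γ δ' st γinc Lmin) :
    kappa A (l0 xbar + 2 * st) * rhoMinus A (l0 xbar + 2 * st)
      = rhoPlus A (l0 xbar + 2 * st) :=
  div_mul_cancel₀ _ hA.rho_pos.ne'

end RecoveryAssumption

theorem l0_sub_le_of_sparse {x y : Fin n → ℝ} (hx : l0Off (supp xbar) x ≤ st)
    (hy : l0Off (supp xbar) y ≤ st) : l0 (x - y) ≤ l0 xbar + 2 * st := by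
  have : l0 (x - y) ≤ l0 xbar + (l0Off (supp xbar) x + l0Off (supp xbar) y) :=
    l0_sub_le (supp xbar) x y
  omega

theorem phi_le_psi_of_rhoPlus_le (A : Matrix (Fin m) (Fin n) ℝ) (b : Fin m → ℝ) (lam : ℝ) {L : ℝ}
    {s : ℕ} {x y : Fin n → ℝ} (h : l0 (y - x) ≤ s) (hL : rhoPlus A s ≤ L) :
    phi A b lam y ≤ psi A b lam L x y := by
  have h1 := le_rhoPlus_mul A h
  have h2 := mul_le_mul_of_nonneg_right hL (dotProduct_self_nonneg' (y - x))
  rw [phi_eq_psi_add A b lam L x y]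
  linarith

/-! ### Existence of a sparse minimizer -/

/-- A global minimizer of the objective that is sparse outside the support of `xbar`. -/
structure SparseMinimizer (A : Matrix (Fin m) (Fin n) ℝ) (b : Fin m → ℝ) (xbar : Fin n → ℝ)
    (st : ℕ) (lam : ℝ) (x : Fin n → ℝ) : Prop where
  sparse : l0Off (supp xbar) x ≤ st
  omega_eq : omega A b lam x = 0

namespace SparseMinimizer

variable {xs : Fin n → ℝ}

theorem phi_add_le (h : SparseMinimizer A b xbar st lam xs) (hl : 0 ≤ lam) (x : Fin n → ℝ) :
    phi A b lam xs + 1 / 2 * ((A *ᵥ (x - xs)) ⬝ᵥ (A *ᵥ (x - xs))) ≤ phi A b lam x := by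
  have := phi_sub_add_le A b hl xs x
  rw [h.omega_eq, zero_mul] at this
  linarith

theorem phi_le (h : SparseMinimizer A b xbar st lam xs) (hl : 0 ≤ lam) (x : Fin n → ℝ) :
    phi A b lam xs ≤ phi A b lam x := by
  have := phi_sub_le A b hl xs x
  rw [h.omega_eq, zero_mul] at this
  linarith

theorem phiStar_eq (h : SparseMinimizer A b xbar st lam xs) (hl : 0 ≤ lam) :
    phiStar A b lam = phi A b lam xs :=
  le_antisymm (ciInf_le ⟨phi A b lam xs, by rintro _ ⟨x, rfl⟩; exact h.phi_le hl x⟩ xs)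
    (le_ciInf (h.phi_le hl))

theorem goodStart (h : SparseMinimizer A b xbar st lam xs) (hl : 0 ≤ lam) (hδ : 0 ≤ δ') :
    GoodStart A b xbar δ' st lam xs :=
  ⟨h.sparse, by rw [h.omega_eq]; positivity⟩

end SparseMinimizer

/-- The objective is coercive, so it has a minimizer `xs` over the closed sparse set. A proximal
step from `xs` stays sparse, so it cannot lower the objective and must fix `xs`; a fixed point has
zero residue, hence is a global minimizer. -/
theorem RecoveryAssumption.exists_sparseMinimizer
    (hA : RecoveryAssumption A b xbar z lamTgt γ δ' st γinc Lmin)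
    (hs : 0 < l0 xbar) (ht : 0 < lamTgt) (hg : 1 < γinc) (hl : lamTgt ≤ lam) :
    ∃ xs, SparseMinimizer A b xbar st lam xs := by
  have hlam := ht.trans_le hl
  have hP := hA.rhoPlus_pos
  have hγ := hA.one_lt_gamma
  have hbar : xbar ∈ {x : Fin n → ℝ | l0Off (supp xbar) x ≤ st} := by
    simp [l0Off_supp_self]
  have hco : Filter.Tendsto (phi A b lam) (Filter.cocompact _) Filter.atTop :=
    Filter.tendsto_atTop_mono (phi_ge_linf A b hlam.le)
      (tendsto_norm_cocompact_atTop.const_mul_atTop hlam)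
  obtain ⟨xs, hxs, hmin⟩ := (continuous_phi A b lam).continuousOn.exists_isMinOn'
    (isClosed_l0Off_le (supp xbar) st) hbar
    ((hco.eventually_ge_atTop (phi A b lam xbar)).filter_mono inf_le_left)
  rw [isMinOn_iff] at hmin
  have hlev : SparseLevel A b xbar γ st lam xs := by
    refine ⟨hxs, (hmin xbar hbar).trans (le_add_of_nonneg_right ?_)⟩
    have := hA.rho_pos'
    positivity
  have hL : 0 < γinc * rhoPlus A (l0 xbar + 2 * st) := by positivity
  obtain ⟨x', hx'⟩ := exists_isProxPoint A b hlam hL xs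
  have hsp := hA.prox_sparse hs ht hl hlev hL le_rfl hx'
  have h1 : phi A b lam x' ≤ psi A b lam (γinc * rhoPlus A (l0 xbar + 2 * st)) xs x' :=
    phi_le_psi_of_rhoPlus_le A b lam (l0_sub_le_of_sparse hsp hxs) (by nlinarith)
  have h2 := hx'.psi_add_le hlam xs
  rw [psi_self] at h2
  have h3 := hmin x' hsp
  have h4 : xs - x' = 0 := by
    by_contra hne
    have := mul_pos (half_pos hL) (dotProduct_self_pos hne)
    linarith
  have h5 : x' = xs := (sub_eq_zero.1 h4).symm
  refine ⟨xs, hxs, le_antisymm ?_ (omega_nonneg _ _ _ _)⟩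
  have h6 := hx'.omega_le hlam
  rw [h5] at h6
  simpa [linf] using h6

/-! ### The line search -/

namespace LineSearch

variable {x x' : Fin n → ℝ} {L M : ℝ}

/-- Trial points are sparse, so any `L ≥ ρ₊` is accepted. A rejected `L` is therefore below `ρ₊`,
and its successor is below `γinc ρ₊`. -/
theorem spec (h : LineSearch A b γinc lam x L x' M)
    (hA : RecoveryAssumption A b xbar z lamTgt γ δ' st γinc Lmin)
    (hs : 0 < l0 xbar) (ht : 0 < lamTgt) (hg : 1 < γinc) (hl : lamTgt ≤ lam)
    (hx : SparseLevel A b xbar γ st lam x) (hL : 0 < L)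
    (hLle : L ≤ γinc * rhoPlus A (l0 xbar + 2 * st)) :
    0 < M ∧ M ≤ γinc * rhoPlus A (l0 xbar + 2 * st) ∧ IsProxPoint A b lam M x x' ∧
      phi A b lam x' ≤ psi A b lam M x x' := by
  induction h with
  | accept L x' h1 h2 => exact ⟨hL, hLle, h1, h2⟩
  | reject L w x' M h1 h2 _ ih =>
    refine ih (by positivity) ?_
    by_contra hc
    have hP : rhoPlus A (l0 xbar + 2 * st) ≤ L := by
      refine le_of_mul_le_mul_left ?_ (by linarith : 0 < γinc)
      linarith
    exact h2.not_ge (phi_le_psi_of_rhoPlus_le A b lam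
      (l0_sub_le_of_sparse (hA.prox_sparse hs ht hl hx hL hLle h1) hx.1) hP)

theorem exists_of_sparseLevel
    (hA : RecoveryAssumption A b xbar z lamTgt γ δ' st γinc Lmin)
    (hs : 0 < l0 xbar) (ht : 0 < lamTgt) (hg : 1 < γinc) (hl : lamTgt ≤ lam)
    (hx : SparseLevel A b xbar γ st lam x) (hL : 0 < L)
    (hLle : L ≤ γinc * rhoPlus A (l0 xbar + 2 * st)) :
    ∃ x' M, LineSearch A b γinc lam x L x' M := by
  have hlam := ht.trans_le hl
  -- After `k` rejections the estimate would exceed `ρ₊`, so `k` bounds their number.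
  obtain ⟨k, hk⟩ := pow_unbounded_of_one_lt (rhoPlus A (l0 xbar + 2 * st) / L) hg
  rw [div_lt_iff₀ hL] at hk
  induction k generalizing L with
  | zero =>
    obtain ⟨x', h1⟩ := exists_isProxPoint A b hlam hL x
    exact ⟨x', L, accept L x' h1 (phi_le_psi_of_rhoPlus_le A b lam
      (l0_sub_le_of_sparse (hA.prox_sparse hs ht hl hx hL hLle h1) hx.1) (by linarith))⟩
  | succ k ih =>
    obtain ⟨w, h1⟩ := exists_isProxPoint A b hlam hL x
    rcases le_or_gt (phi A b lam w) (psi A b lam L x w) with h2 | h2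
    · exact ⟨w, L, accept L w h1 h2⟩
    · have hP : L ≤ rhoPlus A (l0 xbar + 2 * st) := by
        by_contra hc
        exact h2.not_ge (phi_le_psi_of_rhoPlus_le A b lam
          (l0_sub_le_of_sparse (hA.prox_sparse hs ht hl hx hL hLle h1) hx.1) (not_le.1 hc).le)
      obtain ⟨x', M, h3⟩ := ih (L := L * γinc) (by positivity)
        (by rw [mul_comm]; exact mul_le_mul_of_nonneg_left hP (by linarith))
        (by rw [pow_succ] at hk; linarith)
      exact ⟨x', M, reject L w x' M h1 h2 h3⟩

end LineSearch

/-! ### Progress of one step and of a whole call -/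

/-- The effect of one accepted proximal-gradient step. -/
structure StepProperties (A : Matrix (Fin m) (Fin n) ℝ) (b : Fin m → ℝ) (xbar : Fin n → ℝ)
    (γ γinc : ℝ) (st : ℕ) (lam φs : ℝ) (x x' : Fin n → ℝ) : Prop where
  level : SparseLevel A b xbar γ st lam x'
  decrease : phi A b lam x' ≤ phi A b lam x
  contraction : phi A b lam x' - φs
    ≤ (1 - 1 / (4 * γinc * kappa A (l0 xbar + 2 * st))) * (phi A b lam x - φs)
  residue : omega A b lam x' ^ 2 ≤ 2 * γinc * rhoPlus A (l0 xbar + 2 * st)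
    * (1 + kappa A (l0 xbar + 2 * st)) ^ 2 * (phi A b lam x - φs)

theorem psi_segment_le (A : Matrix (Fin m) (Fin n) ℝ) (b : Fin m → ℝ) (hl : 0 ≤ lam) (M : ℝ)
    (x y : Fin n → ℝ) {t : ℝ} (h0 : 0 ≤ t) (h1 : t ≤ 1) :
    psi A b lam M x (x + t • (y - x)) ≤ phi A b lam x + t * (phi A b lam y - phi A b lam x)
      + M / 2 * t ^ 2 * ((y - x) ⬝ᵥ (y - x)) := by
  have h2 := mul_le_mul_of_nonneg_left (l1_segment_le x y h0 h1) hl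
  have h3 := f_eq A b x y
  have h4 := dotProduct_self_nonneg' (A *ᵥ (y - x))
  have h5 : t * (gradf A b x ⬝ᵥ (y - x)) ≤ t * (f A b y - f A b x) :=
    mul_le_mul_of_nonneg_left (by linarith) h0
  rw [psi, phi, phi, add_sub_cancel_left, l2_sq]
  simp only [dotProduct_smul, smul_dotProduct, smul_eq_mul]
  linarith

theorem IsProxPoint.omega_sq_le {M : ℝ} (hl : 0 < lam) (hM : 0 < M) {x x' : Fin n → ℝ}
    (h : IsProxPoint A b lam M x x') {s : ℕ} (hs : 1 ≤ s) (hd : l0 (x' - x) ≤ s) :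
    omega A b lam x' ^ 2 ≤ (rhoPlus A s + M) ^ 2 * ((x' - x) ⬝ᵥ (x' - x)) := by
  have h0 := rhoPlus_nonneg A s
  have h1 : omega A b lam x' ≤ (rhoPlus A s + M) * l2 (x' - x) := by
    refine (h.omega_le hl).trans (linf_le (mul_nonneg (by linarith) (l2_nonneg _)) fun j => ?_)
    have h2 := abs_gram_mulVec_apply_le A hs hd j
    have h3 : |(x' - x) j| ≤ l2 (x' - x) :=
      Real.abs_le_sqrt (Finset.single_le_sum (f := fun i => (x' - x) i ^ 2)
        (fun _ _ => sq_nonneg _) (Finset.mem_univ j))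
    have h4 := abs_sub ((Aᵀ *ᵥ (A *ᵥ (x' - x))) j) (M * (x' - x) j)
    rw [abs_mul, abs_of_pos hM] at h4
    have h5 := mul_le_mul_of_nonneg_left h3 hM.le
    rw [Pi.sub_apply, Pi.smul_apply, smul_eq_mul]
    linarith
  have := pow_le_pow_left₀ (omega_nonneg A b lam x') h1 2
  rwa [mul_pow, l2_sq] at this

/-- For the contraction, the proximal point is compared with `x + t (xs - x)`: restricted strong
convexity bounds the model gap by `(1 - t + γinc κ t²)` times the old gap, and `t = 1 / (2 γinc κ)`
is the minimizer. For the residue, `ω² ≤ (ρ₊ + M)² ‖d‖²` for the step `d`, while `M ‖d‖²` is at most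
twice the gap. -/
theorem LineSearch.stepProperties {x x' xs : Fin n → ℝ} {L M : ℝ}
    (h : LineSearch A b γinc lam x L x' M)
    (hA : RecoveryAssumption A b xbar z lamTgt γ δ' st γinc Lmin)
    (hs : 0 < l0 xbar) (ht : 0 < lamTgt) (hg : 1 < γinc) (hl : lamTgt ≤ lam)
    (hx : SparseLevel A b xbar γ st lam x) (hL : 0 < L)
    (hLle : L ≤ γinc * rhoPlus A (l0 xbar + 2 * st))
    (hxs : SparseMinimizer A b xbar st lam xs) :
    StepProperties A b xbar γ γinc st lam (phi A b lam xs) x x' := by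
  have hlam := ht.trans_le hl
  obtain ⟨hM, hMle, hprox, hacc⟩ := h.spec hA hs ht hg hl hx hL hLle
  have hsp := hA.prox_sparse hs ht hl hx hM hMle hprox
  have hP := hA.rhoPlus_pos
  have hR := hA.rho_pos
  have hκ1 := hA.one_le_kappa
  have hκR := hA.kappa_mul
  have hxx' : l0 (x' - x) ≤ _ := l0_sub_le_of_sparse hsp hx.1
  have hself := hprox.psi_add_le hlam x
  rw [psi_self, ← neg_sub x' x, neg_dotProduct_neg] at hself
  have hdd := dotProduct_self_nonneg' (x' - x)
  have hMdd := mul_nonneg hM.le hdd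
  have hdec : phi A b lam x' ≤ phi A b lam x := by linarith
  have hgap : 0 ≤ phi A b lam x - phi A b lam xs := sub_nonneg.2 (hxs.phi_le hlam.le x)
  refine ⟨⟨hsp, hdec.trans hx.2⟩, hdec, ?_, ?_⟩
  · set κ := kappa A (l0 xbar + 2 * st)
    set R := rhoMinus A (l0 xbar + 2 * st)
    set P := rhoPlus A (l0 xbar + 2 * st)
    have hg0 : 0 < γinc * κ := by positivity
    have ht1 : 1 / (2 * γinc * κ) ≤ 1 := by
      rw [div_le_one (by positivity)]; nlinarith
    have ht0 : 0 < 1 / (2 * γinc * κ) := by positivity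
    have htk : 1 / (2 * γinc * κ) * (γinc * κ) = 1 / 2 := by field_simp
    have h4 : 1 / (4 * γinc * κ) = 1 / (2 * γinc * κ) / 2 := by field_simp; norm_num
    rw [h4]
    set t := 1 / (2 * γinc * κ)
    have h1 := (hprox (x + t • (xs - x))).trans
      (psi_segment_le A b hlam.le M x xs ht0.le ht1)
    have h2 := hxs.phi_add_le hlam.le x
    have h3 : R * ((x - xs) ⬝ᵥ (x - xs)) ≤ _ :=
      rhoMinus_mul_le A (l0_sub_le_of_sparse hx.1 hxs.sparse)
    rw [← neg_sub x xs, neg_dotProduct_neg] at h1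
    have h5 := dotProduct_self_nonneg' (x - xs)
    set D := (x - xs) ⬝ᵥ (x - xs)
    have h6 : M * D ≤ γinc * κ * (R * D) := by
      have := mul_le_mul_of_nonneg_right hMle h5
      rw [← hκR] at this
      linarith
    have h7 : M / 2 * D ≤ γinc * κ * (phi A b lam x - phi A b lam xs) := by
      have := mul_le_mul_of_nonneg_left (h3.trans (by linarith :
        _ ≤ 2 * (phi A b lam x - phi A b lam xs))) hg0.le
      linarith
    have h8 : M / 2 * t ^ 2 * D ≤ t / 2 * (phi A b lam x - phi A b lam xs) := by
      have h9 := mul_le_mul_of_nonneg_left h7 (sq_nonneg t)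
      have h10 : t ^ 2 * (γinc * κ * (phi A b lam x - phi A b lam xs))
          = t * (t * (γinc * κ)) * (phi A b lam x - phi A b lam xs) := by ring
      rw [h10, htk] at h9
      linarith
    linarith
  · have h1 := hprox.omega_sq_le hlam hM hA.one_le_card hxx'
    refine h1.trans ?_
    by_cases hd : x' - x = 0
    · rw [hd, zero_dotProduct, mul_zero]; positivity
    have hdpos := dotProduct_self_pos hd
    -- Acceptance means `‖A d‖² ≤ M ‖d‖²` for the sparse nonzero `d = x' - x`, which forces `M ≥ ρ₋`
    -- and so `ρ₊ ≤ κ M`.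
    have hRM : rhoMinus A (l0 xbar + 2 * st) ≤ M := by
      refine le_of_mul_le_mul_right ?_ hdpos
      have h2 := rhoMinus_mul_le A hxx'
      rw [phi_eq_psi_add A b lam M x x'] at hacc
      linarith
    set κ := kappa A (l0 xbar + 2 * st)
    have hPM : rhoPlus A (l0 xbar + 2 * st) + M ≤ (1 + κ) * M := by
      rw [← hκR]
      have := mul_le_mul_of_nonneg_left hRM (by linarith : 0 ≤ κ)
      linarith
    have h2 := pow_le_pow_left₀ (by positivity) hPM 2
    have h3 := mul_le_mul_of_nonneg_right h2 hdd
    have h4 : M * ((x' - x) ⬝ᵥ (x' - x)) ≤ 2 * (phi A b lam x - phi A b lam xs) := by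
      have := hxs.phi_le hlam.le x'
      linarith
    have h5 := mul_le_mul hMle h4 hMdd (by positivity)
    have h6 := mul_le_mul_of_nonneg_left h5 (sq_nonneg (1 + κ))
    linarith

/-- What a terminating execution of the proximal gradient method provides. -/
structure ProxGradProperties (A : Matrix (Fin m) (Fin n) ℝ) (b : Fin m → ℝ) (xbar : Fin n → ℝ)
    (γ γinc : ℝ) (st : ℕ) (lam tol φs : ℝ) (x xhat : Fin n → ℝ) (Mhat : ℝ) (k : ℕ) : Prop where
  level : SparseLevel A b xbar γ st lam xhat
  residue : omega A b lam xhat ≤ tol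
  estimate_pos : 0 < Mhat
  estimate_le : Mhat ≤ γinc * rhoPlus A (l0 xbar + 2 * st)
  steps : k = 1 ∨ 2 ≤ k ∧ tol ^ 2 < (1 - 1 / (4 * γinc * kappa A (l0 xbar + 2 * st))) ^ (k - 2)
    * (2 * γinc * rhoPlus A (l0 xbar + 2 * st)
    * (1 + kappa A (l0 xbar + 2 * st)) ^ 2 * (phi A b lam x - φs))

theorem RecoveryAssumption.rate_bounds
    (hA : RecoveryAssumption A b xbar z lamTgt γ δ' st γinc Lmin) (hg : 1 < γinc) :
    3 / 4 ≤ 1 - 1 / (4 * γinc * kappa A (l0 xbar + 2 * st)) ∧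
      1 - 1 / (4 * γinc * kappa A (l0 xbar + 2 * st)) < 1 := by
  have := hA.one_le_kappa
  have h1 : 1 / (4 * γinc * kappa A (l0 xbar + 2 * st)) ≤ 1 / 4 :=
    one_div_le_one_div_of_le (by norm_num) (by nlinarith)
  have h2 : 0 < 1 / (4 * γinc * kappa A (l0 xbar + 2 * st)) := by positivity
  constructor <;> linarith

theorem next_estimate_le (hA : RecoveryAssumption A b xbar z lamTgt γ δ' st γinc Lmin)
    (hd : 1 ≤ γdec) {M : ℝ} (hM : 0 < M) (hMle : M ≤ γinc * rhoPlus A (l0 xbar + 2 * st)) :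
    max Lmin (M / γdec) ≤ γinc * rhoPlus A (l0 xbar + 2 * st) :=
  max_le hA.Lmin_le ((div_le_self hM.le hd).trans hMle)

/-- The exponent `k - 2`: a run of `k ≥ 2` steps did not stop at iterate `k - 1`, whose residue is
controlled by the gap at iterate `k - 2`, and that gap has contracted `k - 2` times. -/
theorem ProxGrad.properties {tol : ℝ} {x xs xhat : Fin n → ℝ} {L Mhat : ℝ} {k : ℕ}
    (h : ProxGrad A b γinc γdec Lmin lam tol x L xhat Mhat k)
    (hA : RecoveryAssumption A b xbar z lamTgt γ δ' st γinc Lmin)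
    (hs : 0 < l0 xbar) (ht : 0 < lamTgt) (hg : 1 < γinc) (hd : 1 ≤ γdec) (hLmin : 0 < Lmin)
    (hl : lamTgt ≤ lam) (htol : 0 ≤ tol)
    (hx : SparseLevel A b xbar γ st lam x) (hL : 0 < L)
    (hLle : L ≤ γinc * rhoPlus A (l0 xbar + 2 * st))
    (hxs : SparseMinimizer A b xbar st lam xs) :
    ProxGradProperties A b xbar γ γinc st lam tol (phi A b lam xs) x xhat Mhat k := by
  induction h with
  | last x L x' M h1 h2 =>
    obtain ⟨hM, hMle, -, -⟩ := h1.spec hA hs ht hg hl hx hL hLle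
    exact ⟨(h1.stepProperties hA hs ht hg hl hx hL hLle hxs).level, h2, hM, hMle, Or.inl rfl⟩
  | next x L x' M xhat Mhat k h1 h2 _ ih =>
    obtain ⟨hM, hMle, -, -⟩ := h1.spec hA hs ht hg hl hx hL hLle
    have hstep := h1.stepProperties hA hs ht hg hl hx hL hLle hxs
    have h3 := ih hstep.level (lt_max_of_lt_left hLmin) (next_estimate_le hA hd hM hMle)
    refine ⟨h3.level, h3.residue, h3.estimate_pos, h3.estimate_le, Or.inr ?_⟩
    have hP := hA.rhoPlus_pos
    obtain ⟨hr, -⟩ := hA.rate_bounds hg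
    rcases h3.steps with rfl | ⟨hk, h4⟩
    · refine ⟨le_rfl, ?_⟩
      rw [Nat.sub_self, pow_zero, one_mul]
      exact (pow_lt_pow_left₀ h2 htol two_ne_zero).trans_le hstep.residue
    · refine ⟨by omega, h4.trans_le ?_⟩
      obtain ⟨j, rfl⟩ := Nat.exists_eq_add_of_le hk
      have e1 : 2 + j - 2 = j := by omega
      have e2 : 2 + j + 1 - 2 = j + 1 := by omega
      rw [e1, e2, pow_succ _ j, mul_assoc (_ ^ j)]
      refine mul_le_mul_of_nonneg_left ?_ (pow_nonneg (by linarith) _)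
      have := mul_le_mul_of_nonneg_left hstep.contraction (by positivity :
        0 ≤ 2 * γinc * rhoPlus A (l0 xbar + 2 * st) * (1 + kappa A (l0 xbar + 2 * st)) ^ 2)
      linarith

/-- Induction on a power `j` for which the contracted residue bound is below `tol ^ 2`: each step
uses up one factor of the rate. -/
theorem ProxGrad.exists_of_sparseLevel {tol : ℝ} {x : Fin n → ℝ} {L : ℝ}
    (hA : RecoveryAssumption A b xbar z lamTgt γ δ' st γinc Lmin)
    (hs : 0 < l0 xbar) (ht : 0 < lamTgt) (hg : 1 < γinc) (hd : 1 ≤ γdec) (hLmin : 0 < Lmin)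
    (hl : lamTgt ≤ lam) (htol : 0 < tol)
    (hx : SparseLevel A b xbar γ st lam x) (hL : 0 < L)
    (hLle : L ≤ γinc * rhoPlus A (l0 xbar + 2 * st)) :
    ∃ xhat Mhat k, ProxGrad A b γinc γdec Lmin lam tol x L xhat Mhat k := by
  obtain ⟨xs, hxs⟩ := hA.exists_sparseMinimizer hs ht hg hl
  obtain ⟨hr0, hr1⟩ := hA.rate_bounds hg
  have hP := hA.rhoPlus_pos
  have key : ∀ (j : ℕ) (x : Fin n → ℝ) (L : ℝ), SparseLevel A b xbar γ st lam x → 0 < L →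
      L ≤ γinc * rhoPlus A (l0 xbar + 2 * st) →
      (1 - 1 / (4 * γinc * kappa A (l0 xbar + 2 * st))) ^ j
        * (2 * γinc * rhoPlus A (l0 xbar + 2 * st) * (1 + kappa A (l0 xbar + 2 * st)) ^ 2
        * (phi A b lam x - phi A b lam xs)) ≤ tol ^ 2 →
      ∃ xhat Mhat k, ProxGrad A b γinc γdec Lmin lam tol x L xhat Mhat k := by
    intro j
    induction j with
    | zero =>
      intro x L hx hL hLle hj
      obtain ⟨x', M, h1⟩ := LineSearch.exists_of_sparseLevel hA hs ht hg hl hx hL hLle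
      have hstep := h1.stepProperties hA hs ht hg hl hx hL hLle hxs
      rw [pow_zero, one_mul] at hj
      exact ⟨x', M, 1, .last x L x' M h1
        (abs_le_of_sq_le_sq' (hstep.residue.trans hj) htol.le).2⟩
    | succ j ih =>
      intro x L hx hL hLle hj
      obtain ⟨x', M, h1⟩ := LineSearch.exists_of_sparseLevel hA hs ht hg hl hx hL hLle
      have hstep := h1.stepProperties hA hs ht hg hl hx hL hLle hxs
      obtain ⟨hM, hMle, -, -⟩ := h1.spec hA hs ht hg hl hx hL hLle
      rcases le_or_gt (omega A b lam x') tol with h2 | h2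
      · exact ⟨x', M, 1, .last x L x' M h1 h2⟩
      obtain ⟨xhat, Mhat, k, h3⟩ := ih x' (max Lmin (M / γdec)) hstep.level
        (lt_max_of_lt_left hLmin) (next_estimate_le hA hd hM hMle) (by
          refine le_trans ?_ hj
          rw [pow_succ _ j, mul_assoc (_ ^ j)]
          refine mul_le_mul_of_nonneg_left ?_ (pow_nonneg (by linarith) _)
          have := mul_le_mul_of_nonneg_left hstep.contraction (by positivity :
            0 ≤ 2 * γinc * rhoPlus A (l0 xbar + 2 * st)
              * (1 + kappa A (l0 xbar + 2 * st)) ^ 2)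
          linarith)
      exact ⟨xhat, Mhat, k + 1, .next x L x' M xhat Mhat k h1 h2 h3⟩
  have hlim := (tendsto_pow_atTop_nhds_zero_of_lt_one (by linarith) hr1).mul_const
    (2 * γinc * rhoPlus A (l0 xbar + 2 * st) * (1 + kappa A (l0 xbar + 2 * st)) ^ 2
        * (phi A b lam x - phi A b lam xs))
  rw [zero_mul] at hlim
  obtain ⟨j, hj⟩ := (hlim.eventually_le_const (by positivity : 0 < tol ^ 2)).exists
  exact key j x L hx hL hLle hj

end ProxGradAnalysis

/-! ### The homotopy method -/

theorem natCast_le_log_div {r X : ℝ} (hr : 0 < r) (hr1 : r < 1) (hX : 0 < X) {j : ℕ}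
    (h : 1 ≤ r ^ j * X) : (j : ℝ) ≤ Real.log X / Real.log r⁻¹ := by
  have h1 : 0 < Real.log r⁻¹ := Real.log_pos (one_lt_inv_iff₀.2 ⟨hr, hr1⟩)
  rw [le_div_iff₀ h1, Real.log_inv]
  have h2 := Real.log_nonneg h
  rw [Real.log_mul (pow_pos hr j).ne' hX.ne', Real.log_pow] at h2
  linarith

section Homotopy

variable {A : Matrix (Fin m) (Fin n) ℝ} {b : Fin m → ℝ} {xbar : Fin n → ℝ} {z : Fin m → ℝ}
  {lamTgt γ δ δ' η γinc γdec Lmin lam : ℝ} {st : ℕ}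

/-- If `xbar = 0` then `b = z`, and `lam_0 = ‖Aᵀz‖_∞ ≤ lamTgt / 4` contradicts `lamTgt ≤ lam_0`. -/
theorem RecoveryAssumption.card_pos
    (hA : RecoveryAssumption A b xbar z lamTgt γ δ' st γinc Lmin) (ht : 0 < lamTgt)
    (h0 : lamTgt ≤ lam0 A b) : 0 < l0 xbar := by
  by_contra hc
  have h1 : xbar = 0 := by
    have : supp xbar = ∅ := by
      rw [← Finset.card_eq_zero]
      exact Nat.eq_zero_of_not_pos hc
    funext j
    by_contra hj
    exact Finset.notMem_empty j (this ▸ mem_supp.2 hj)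
  have h2 := hA.noise_le le_rfl
  have h3 : b = z := by rw [hA.model, h1, Matrix.mulVec_zero, zero_add]
  rw [lam0, h3] at h0
  linarith

theorem RecoveryAssumption.le_constC
    (hA : RecoveryAssumption A b xbar z lamTgt γ δ' st γinc Lmin) (hs : 0 < l0 xbar)
    (hg : 1 < γinc) :
    64 ≤ constC γinc (kappa A (l0 xbar + 2 * st)) γ (l0 xbar) := by
  have h1 := hA.one_le_kappa
  have h2 := hA.one_lt_gamma
  have h3 : (1 : ℝ) ≤ l0 xbar := Nat.one_le_cast.2 hs
  calc (64 : ℝ) = 8 * 1 * (1 + 1) ^ 2 * (1 + 1) * 1 * 1 := by norm_num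
    _ ≤ 8 * γinc * (1 + kappa A (l0 xbar + 2 * st)) ^ 2 * (1 + γ)
          * kappa A (l0 xbar + 2 * st) * (l0 xbar) := by gcongr

/-- Both `x` and the minimizer are within `(1 + γ) / 2 * lam * q` of `xbar`, and the residue is at
most `lam`, so the gap is at most `(1 + γ) lam² q`. The spare factor `1 / 4` later pays for three
extra steps. -/
theorem RecoveryAssumption.initial_gap_le
    (hA : RecoveryAssumption A b xbar z lamTgt γ δ' st γinc Lmin) (hs : 0 < l0 xbar)
    (ht : 0 < lamTgt) (hg : 1 < γinc) (hl : lamTgt ≤ lam) {x xs : Fin n → ℝ}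
    (hx : GoodStart A b xbar δ' st lam x) (hxs : SparseMinimizer A b xbar st lam xs) :
    2 * γinc * rhoPlus A (l0 xbar + 2 * st) * (1 + kappa A (l0 xbar + 2 * st)) ^ 2
        * (phi A b lam x - phi A b lam xs)
      ≤ constC γinc (kappa A (l0 xbar + 2 * st)) γ (l0 xbar) * lam ^ 2 / 4 := by
  have hlam := ht.trans_le hl
  have hP := hA.rhoPlus_pos
  have hR := hA.rho_pos
  have hρ := hA.rho_pos'
  have hκ := hA.one_le_kappa
  have hγ := hA.one_lt_gamma
  have h1 := l1_sub_le_add x xs xbar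
  have h2 := hA.l1_sub_le hs ht hl hx
  have h3 := hA.l1_sub_le hs ht hl (hxs.goodStart hlam.le hA.delta_pos.le)
  have h4 : omega A b lam x ≤ lam :=
    hx.2.trans (mul_le_of_le_one_left hlam.le hA.delta_lt_one.le)
  have h5 := (phi_sub_le A b hlam.le x xs).trans
    (mul_le_mul h4 (h1.trans (add_le_add h2 h3)) (l1_nonneg _) hlam.le)
  have h6 : rhoPlus A (l0 xbar + 2 * st) * ((l0 xbar : ℝ) / rhoMinus A (l0 xbar + st))
      ≤ kappa A (l0 xbar + 2 * st) * (l0 xbar) := by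
    rw [kappa, div_mul_eq_mul_div, mul_div_assoc]
    exact mul_le_mul_of_nonneg_left
      (div_le_div_of_nonneg_left (Nat.cast_nonneg _) hR hA.rhoMinus_le) hP.le
  have h7 := mul_le_mul_of_nonneg_left h5 (by positivity :
    0 ≤ 2 * γinc * rhoPlus A (l0 xbar + 2 * st) * (1 + kappa A (l0 xbar + 2 * st)) ^ 2)
  have h8 := mul_le_mul_of_nonneg_left h6 (by positivity :
    0 ≤ 2 * γinc * (1 + kappa A (l0 xbar + 2 * st)) ^ 2 * ((1 + γ) * lam ^ 2))
  rw [constC]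
  linarith

/-- The number of steps of a call with a good starting point. -/
theorem ProxGradProperties.steps_le {tol : ℝ} {x xs xhat : Fin n → ℝ} {Mhat : ℝ} {k : ℕ}
    (h : ProxGradProperties A b xbar γ γinc st lam tol (phi A b lam xs) x xhat Mhat k)
    (hA : RecoveryAssumption A b xbar z lamTgt γ δ' st γinc Lmin) (hs : 0 < l0 xbar)
    (ht : 0 < lamTgt) (hg : 1 < γinc) (hl : lamTgt ≤ lam) (htol : 0 < tol)
    (hx : GoodStart A b xbar δ' st lam x) (hxs : SparseMinimizer A b xbar st lam xs) :
    k = 1 ∨ (k : ℝ) + 1 ≤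
      Real.log (lam ^ 2 * constC γinc (kappa A (l0 xbar + 2 * st)) γ (l0 xbar) / tol ^ 2)
        / Real.log (1 - 1 / (4 * γinc * kappa A (l0 xbar + 2 * st)))⁻¹ := by
  refine h.steps.imp_right fun ⟨hk, hlt⟩ => ?_
  obtain ⟨hr, hr1⟩ := hA.rate_bounds hg
  have hlam := ht.trans_le hl
  have hC := hA.le_constC (γinc := γinc) hs hg
  have hgap := hA.initial_gap_le hs ht hg hl hx hxs
  set C := constC γinc (kappa A (l0 xbar + 2 * st)) γ (l0 xbar)
  set r := 1 - 1 / (4 * γinc * kappa A (l0 xbar + 2 * st))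
  have hr0 : 0 < r := by linarith
  obtain ⟨j, rfl⟩ := Nat.exists_eq_add_of_le hk
  rw [Nat.add_sub_cancel_left] at hlt
  have h1 := natCast_le_log_div (r := r) (X := lam ^ 2 * C / tol ^ 2) (j := 2 + j + 1) hr0 hr1
    (by positivity) (by
      rw [mul_div_assoc', le_div_iff₀ (by positivity), one_mul]
      have e : r ^ (2 + j + 1) = r ^ j * r ^ 3 := by ring
      -- The factor `1 / 4` of `hgap` is traded for `r ^ 3`, raising the exponent from `k - 2` to `k
      -- + 1`.
      have h2 : 1 / 4 ≤ r ^ 3 := le_trans (by norm_num) (pow_le_pow_left₀ (by norm_num) hr 3)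
      have h3 := mul_le_mul_of_nonneg_left hgap (pow_pos hr0 j).le
      have h4 := mul_le_mul_of_nonneg_left h2 (by positivity : 0 ≤ r ^ j * (lam ^ 2 * C))
      rw [e]
      linarith)
  rwa [Nat.cast_add_one] at h1

/-- The new residue is at most `δ lam + (lam - lam')`. This is at most `δ' lam'` exactly when `(1 +
δ) lam ≤ (1 + δ') lam'`. -/
theorem goodStart_of_le (hlam : 0 ≤ lam) (hδ' : 0 < 1 + δ')
    (hη : (1 + δ) / (1 + δ') ≤ η) {lam' : ℝ} (h1 : lam' ≤ lam) (h2 : η * lam ≤ lam')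
    {x : Fin n → ℝ} (hx : GoodStart A b xbar δ st lam x) :
    GoodStart A b xbar δ' st lam' x := by
  refine ⟨hx.1, (omega_le_omega_add A b h1 x).trans ?_⟩
  rw [div_le_iff₀ hδ'] at hη
  have h3 := mul_le_mul_of_nonneg_right hη hlam
  have h4 := mul_le_mul_of_nonneg_left h2 hδ'.le
  linarith [hx.2]

theorem le_lamSeq (ht : 0 < lamTgt) (h0 : lamTgt ≤ lam0 A b) (hη0 : 0 < η) (hη1 : η < 1) {K : ℕ}
    (hK : K ≤ numStages A b η lamTgt) : lamTgt ≤ lamSeq A b η K := by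
  have hl0 := ht.trans_le h0
  have hlog : 0 < Real.log (1 / η) := Real.log_pos (one_lt_one_div hη0 hη1)
  have h1 : (K : ℝ) ≤ Real.log (lam0 A b / lamTgt) / Real.log (1 / η) :=
    (Nat.cast_le.2 hK).trans (Nat.floor_le
      (div_nonneg (Real.log_nonneg ((one_le_div ht).2 h0)) hlog.le))
  rw [le_div_iff₀ hlog, ← Real.log_pow, Real.log_le_log_iff (by positivity) (by positivity),
    one_div, inv_pow, inv_le_iff_one_le_mul₀ (by positivity), div_mul_eq_mul_div,
    le_div_iff₀ ht] at h1
  rw [lamSeq]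
  linarith

/-- The final drop from `lam_N` to `lamTgt` is no steeper than an ordinary stage. -/
theorem mul_lamSeq_le (ht : 0 < lamTgt) (h0 : lamTgt ≤ lam0 A b) (hη0 : 0 < η) (hη1 : η < 1) :
    η * lamSeq A b η (numStages A b η lamTgt) ≤ lamTgt := by
  have hl0 := ht.trans_le h0
  have hlog : 0 < Real.log (1 / η) := Real.log_pos (one_lt_one_div hη0 hη1)
  have h1 : Real.log (lam0 A b / lamTgt) / Real.log (1 / η)
      ≤ ((numStages A b η lamTgt + 1 : ℕ) : ℝ) := by
    rw [Nat.cast_add_one]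
    exact (Nat.lt_floor_add_one _).le
  rw [div_le_iff₀ hlog, ← Real.log_pow, Real.log_le_log_iff (by positivity) (by positivity),
    one_div, inv_pow, le_inv_comm₀ (by positivity) (by positivity), inv_div,
    le_div_iff₀ hl0, pow_succ] at h1
  rw [lamSeq]
  linarith

theorem lamSeq_succ (A : Matrix (Fin m) (Fin n) ℝ) (b : Fin m → ℝ) (η : ℝ) (K : ℕ) :
    lamSeq A b η (K + 1) = η * lamSeq A b η K := by
  rw [lamSeq, lamSeq, pow_succ]; ring

/-- The state of the homotopy method before stage `K`. -/
def StageInvariant (A : Matrix (Fin m) (Fin n) ℝ) (b : Fin m → ℝ) (xbar : Fin n → ℝ)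
    (η δ γinc : ℝ) (st K : ℕ) (x : Fin n → ℝ) (M : ℝ) : Prop :=
  GoodStart A b xbar δ st (lamSeq A b η K) x ∧ 0 < M ∧
    M ≤ γinc * rhoPlus A (l0 xbar + 2 * st)

theorem stageInvariant_zero (hA : RecoveryAssumption A b xbar z lamTgt γ δ' st γinc Lmin)
    (ht : 0 < lamTgt) (h0 : lamTgt ≤ lam0 A b) (hLmin : 0 < Lmin) (hδ : 0 < δ) :
    StageInvariant A b xbar η δ γinc st 0 0 Lmin := by
  have hl0 := ht.trans_le h0
  refine ⟨⟨?_, ?_⟩, hLmin, hA.Lmin_le⟩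
  · simp [l0Off, supp]
  · rw [lamSeq, pow_zero, one_mul]
    exact (omega_zero_le hl0).trans (by positivity)

/-- The hypotheses of the analysis of the homotopy method. -/
structure HomotopySetup (A : Matrix (Fin m) (Fin n) ℝ) (b : Fin m → ℝ)
    (xbar : Fin n → ℝ) (z : Fin m → ℝ) (lamTgt γ δ' : ℝ) (st : ℕ) (γinc γdec Lmin η δ : ℝ) :
    Prop where
  recovery : RecoveryAssumption A b xbar z lamTgt γ δ' st γinc Lmin
  lamTgt_pos : 0 < lamTgt
  lamTgt_le : lamTgt ≤ lam0 A b
  Lmin_pos : 0 < Lmin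
  one_lt_inc : 1 < γinc
  one_le_dec : 1 ≤ γdec
  delta_pos : 0 < δ
  delta_lt_one : δ < 1
  le_eta : (1 + δ) / (1 + δ') ≤ η
  eta_lt_one : η < 1

/-! ### Chaining the stages -/

namespace HomotopySetup

variable (H : HomotopySetup A b xbar z lamTgt γ δ' st γinc γdec Lmin η δ)
include H

theorem card_pos : 0 < l0 xbar := H.recovery.card_pos H.lamTgt_pos H.lamTgt_le

theorem one_add_pos : 0 < 1 + δ' := by linarith [H.recovery.delta_pos]

theorem eta_pos : 0 < η :=
  lt_of_lt_of_le (div_pos (by linarith [H.delta_pos]) H.one_add_pos) H.le_eta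

theorem le_lamSeq {K : ℕ} (hK : K ≤ numStages A b η lamTgt) : lamTgt ≤ lamSeq A b η K :=
  PGH.le_lamSeq H.lamTgt_pos H.lamTgt_le H.eta_pos H.eta_lt_one hK

variable {K : ℕ} {x x' : Fin n → ℝ} {M M' : ℝ} {k : ℕ}

theorem goodStart_succ (hK : K < numStages A b η lamTgt)
    (h : StageInvariant A b xbar η δ γinc st K x M) :
    GoodStart A b xbar δ' st (lamSeq A b η (K + 1)) x := by
  have h0 := H.lamTgt_pos.le.trans (H.le_lamSeq hK.le)
  refine goodStart_of_le h0 H.one_add_pos H.le_eta ?_ (lamSeq_succ A b η K).ge h.1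
  rw [lamSeq_succ]
  exact mul_le_of_le_one_left h0 H.eta_lt_one.le

theorem goodStart_final (h : StageInvariant A b xbar η δ γinc st (numStages A b η lamTgt) x M) :
    GoodStart A b xbar δ' st lamTgt x :=
  goodStart_of_le (H.lamTgt_pos.le.trans (H.le_lamSeq le_rfl)) H.one_add_pos H.le_eta
    (H.le_lamSeq le_rfl)
    (PGH.mul_lamSeq_le H.lamTgt_pos H.lamTgt_le H.eta_pos H.eta_lt_one) h.1

theorem exists_proxGrad (hl : lamTgt ≤ lam) {tol : ℝ} (htol : 0 < tol)
    (hx : GoodStart A b xbar δ' st lam x) (hM : 0 < M)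
    (hMle : M ≤ γinc * rhoPlus A (l0 xbar + 2 * st)) :
    ∃ x' M' k, ProxGrad A b γinc γdec Lmin lam tol x M x' M' k :=
  ProxGrad.exists_of_sparseLevel H.recovery H.card_pos H.lamTgt_pos H.one_lt_inc H.one_le_dec
    H.Lmin_pos hl htol (H.recovery.sparseLevel H.card_pos H.lamTgt_pos hl hx) hM hMle

theorem proxGrad_properties (hl : lamTgt ≤ lam) {tol : ℝ} (htol : 0 < tol)
    (hx : GoodStart A b xbar δ' st lam x) (hM : 0 < M)
    (hMle : M ≤ γinc * rhoPlus A (l0 xbar + 2 * st))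
    (h : ProxGrad A b γinc γdec Lmin lam tol x M x' M' k) :
    ∃ xs, SparseMinimizer A b xbar st lam xs ∧
      ProxGradProperties A b xbar γ γinc st lam tol (phi A b lam xs) x x' M' k := by
  obtain ⟨xs, hxs⟩ :=
    H.recovery.exists_sparseMinimizer H.card_pos H.lamTgt_pos H.one_lt_inc hl
  exact ⟨xs, hxs, h.properties H.recovery H.card_pos H.lamTgt_pos H.one_lt_inc H.one_le_dec
    H.Lmin_pos hl htol.le (H.recovery.sparseLevel H.card_pos H.lamTgt_pos hl hx) hM hMle hxs⟩

theorem tol_pos (hK : K ≤ numStages A b η lamTgt) : 0 < δ * lamSeq A b η K :=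
  mul_pos H.delta_pos (H.lamTgt_pos.trans_le (H.le_lamSeq hK))

theorem stageInvariant_succ (hK : K < numStages A b η lamTgt)
    (h : StageInvariant A b xbar η δ γinc st K x M)
    (hp : ProxGrad A b γinc γdec Lmin (lamSeq A b η (K + 1)) (δ * lamSeq A b η (K + 1))
      x M x' M' k) :
    StageInvariant A b xbar η δ γinc st (K + 1) x' M' := by
  obtain ⟨xs, -, h1⟩ := H.proxGrad_properties (H.le_lamSeq hK) (H.tol_pos hK)
    (H.goodStart_succ hK h) h.2.1 h.2.2 hp
  exact ⟨⟨h1.level.1, h1.residue⟩, h1.estimate_pos, h1.estimate_le⟩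

theorem exists_homotopyRun {ε : ℝ} (hε : 0 < ε) :
    ∃ (xhat : ℕ → Fin n → ℝ) (Mhat : ℕ → ℝ) (steps : ℕ → ℕ)
      (xtgt : Fin n → ℝ) (Mtgt : ℝ) (stepsTgt : ℕ),
      HomotopyRun A b γinc γdec Lmin η δ lamTgt ε xhat Mhat steps xtgt Mtgt stepsTgt := by
  have hstage : ∀ (K : ℕ) (p : (Fin n → ℝ) × ℝ), ∃ q : ((Fin n → ℝ) × ℝ) × ℕ,
      K < numStages A b η lamTgt → StageInvariant A b xbar η δ γinc st K p.1 p.2 →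
      ProxGrad A b γinc γdec Lmin (lamSeq A b η (K + 1)) (δ * lamSeq A b η (K + 1))
        p.1 p.2 q.1.1 q.1.2 q.2 := by
    intro K p
    by_cases h : K < numStages A b η lamTgt ∧ StageInvariant A b xbar η δ γinc st K p.1 p.2
    · obtain ⟨x', M', k, hk⟩ := H.exists_proxGrad (H.le_lamSeq h.1) (H.tol_pos h.1)
        (H.goodStart_succ h.1 h.2) h.2.2.1 h.2.2.2
      exact ⟨((x', M'), k), fun _ _ => hk⟩
    · exact ⟨(p, 0), fun h1 h2 => (h ⟨h1, h2⟩).elim⟩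
  choose F hF using hstage
  let seq : ℕ → (Fin n → ℝ) × ℝ := fun K => Nat.rec (0, Lmin) (fun K p => (F K p).1) K
  have hinv : ∀ K ≤ numStages A b η lamTgt,
      StageInvariant A b xbar η δ γinc st K (seq K).1 (seq K).2 := by
    intro K
    induction K with
    | zero =>
      exact fun _ =>
        stageInvariant_zero H.recovery H.lamTgt_pos H.lamTgt_le H.Lmin_pos H.delta_pos
    | succ K ih =>
      intro hK
      exact H.stageInvariant_succ hK (ih (Nat.le_of_lt hK)) (hF K (seq K) hK (ih (Nat.le_of_lt hK)))
  have hN := hinv _ le_rfl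
  obtain ⟨x', M', k, hk⟩ := H.exists_proxGrad le_rfl hε (H.goodStart_final hN) hN.2.1 hN.2.2
  exact ⟨fun K => (seq K).1, fun K => (seq K).2, fun K => (F K (seq K)).2, x', M', k,
    rfl, rfl, fun K hK => hF K (seq K) hK (hinv K hK.le), hk⟩

theorem stageInvariant_of_run {ε : ℝ} {xhat : ℕ → Fin n → ℝ} {Mhat : ℕ → ℝ} {steps : ℕ → ℕ}
    {xtgt : Fin n → ℝ} {Mtgt : ℝ} {stepsTgt : ℕ}
    (hr : HomotopyRun A b γinc γdec Lmin η δ lamTgt ε xhat Mhat steps xtgt Mtgt stepsTgt)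
    (hK : K ≤ numStages A b η lamTgt) :
    StageInvariant A b xbar η δ γinc st K (xhat K) (Mhat K) := by
  induction K with
  | zero =>
    rw [hr.init_x, hr.init_M]
    exact stageInvariant_zero H.recovery H.lamTgt_pos H.lamTgt_le H.Lmin_pos H.delta_pos
  | succ K ih => exact H.stageInvariant_succ hK (ih (Nat.le_of_lt hK)) (hr.stage K hK)

theorem stage_steps_le (hK : K < numStages A b η lamTgt)
    (h : StageInvariant A b xbar η δ γinc st K x M)
    (hp : ProxGrad A b γinc γdec Lmin (lamSeq A b η (K + 1)) (δ * lamSeq A b η (K + 1))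
      x M x' M' k) :
    (k : ℝ) + 1 ≤ Real.log (constC γinc (kappa A (l0 xbar + 2 * st)) γ (l0 xbar) / δ ^ 2)
      / Real.log (1 - 1 / (4 * γinc * kappa A (l0 xbar + 2 * st)))⁻¹ := by
  have hgs := H.goodStart_succ hK h
  obtain ⟨xs, hxs, h1⟩ := H.proxGrad_properties (H.le_lamSeq hK) (H.tol_pos hK) hgs
    h.2.1 h.2.2 hp
  have hlam := H.lamTgt_pos.trans_le (H.le_lamSeq hK)
  have hδ := H.delta_pos
  have hC := H.recovery.le_constC (γinc := γinc) H.card_pos H.one_lt_inc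
  obtain ⟨hr, hr1⟩ := H.recovery.rate_bounds H.one_lt_inc
  rcases h1.steps_le H.recovery H.card_pos H.lamTgt_pos H.one_lt_inc (H.le_lamSeq hK)
    (H.tol_pos hK) hgs hxs with rfl | h2
  -- A one-step stage also satisfies the bound with `k + 1`, since `r² C / δ² ≥ (9 / 16) * 64 > 1`.
  -- The unit saved per stage is needed in the total count.
  · have := natCast_le_log_div (r := 1 - 1 / (4 * γinc * kappa A (l0 xbar + 2 * st)))
      (X := constC γinc (kappa A (l0 xbar + 2 * st)) γ (l0 xbar) / δ ^ 2) (j := 2)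
      (by linarith) hr1 (by positivity) (by
        rw [mul_div_assoc', le_div_iff₀ (by positivity), one_mul]
        have h3 : δ ^ 2 ≤ 1 := pow_le_one₀ hδ.le H.delta_lt_one.le
        have h4 := mul_le_mul (pow_le_pow_left₀ (by norm_num) hr 2) hC (by norm_num)
          (sq_nonneg _)
        refine h3.trans (le_trans ?_ h4)
        norm_num)
    norm_num at this ⊢
    exact this
  · have e : lamSeq A b η (K + 1) ^ 2 * constC γinc (kappa A (l0 xbar + 2 * st)) γ (l0 xbar)
        / (δ * lamSeq A b η (K + 1)) ^ 2
        = constC γinc (kappa A (l0 xbar + 2 * st)) γ (l0 xbar) / δ ^ 2 := by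
      field_simp
    rwa [e] at h2

/-- Suboptimality at the target parameter of a good point for a larger parameter. -/
theorem phi_target_sub_le (hl : lamTgt ≤ lam) (hx : GoodStart A b xbar δ' st lam x) :
    phi A b lamTgt x - phiStar A b lamTgt
      ≤ 4.5 * (1 + γ) * lam ^ 2 * ((l0 xbar : ℝ) / rhoMinus A (l0 xbar + st)) := by
  have hA := H.recovery
  have ht := H.lamTgt_pos
  obtain ⟨xs, hxs⟩ := hA.exists_sparseMinimizer H.card_pos ht H.one_lt_inc le_rfl
  rw [hxs.phiStar_eq ht.le]
  have h1 := l1_sub_le_add x xs xbar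
  have h2 := hA.l1_sub_le H.card_pos ht hl hx
  have h3 := hA.l1_sub_le H.card_pos ht le_rfl (hxs.goodStart ht.le hA.delta_pos.le)
  have h4 : omega A b lamTgt x ≤ 2 * lam := by
    have := mul_le_of_le_one_left (ht.le.trans hl) hA.delta_lt_one.le
    linarith [omega_le_omega_add A b hl x, hx.2]
  have hγ := hA.one_lt_gamma
  have hρ := hA.rho_pos'
  set q := (l0 xbar : ℝ) / rhoMinus A (l0 xbar + st) with hq
  have hq0 : 0 ≤ (1 + γ) * q := by positivity
  have h5 : l1 (x - xs) ≤ (1 + γ) * lam * q := by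
    have := mul_le_mul_of_nonneg_left hl hq0
    linarith
  have h6 := (phi_sub_le A b ht.le x xs).trans
    (mul_le_mul h4 h5 (l1_nonneg _) (by linarith))
  have h7 : 0 ≤ (1 + γ) * q * lam ^ 2 := by positivity
  linarith

/-- As `ε` is arbitrary, the output need not have residue at most `δ' lamTgt`. Its distance to
`xbar` comes from the level bound, and `8 / 3 + 1 / 2 ≤ 4`. -/
theorem phi_output_sub_le {ε : ℝ} (hx : SparseLevel A b xbar γ st lamTgt x)
    (hω : omega A b lamTgt x ≤ ε) :
    phi A b lamTgt x - phiStar A b lamTgt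
      ≤ 4 * (1 + γ) * lamTgt * ((l0 xbar : ℝ) / rhoMinus A (l0 xbar + st)) * ε := by
  have hA := H.recovery
  have ht := H.lamTgt_pos
  obtain ⟨xs, hxs⟩ := hA.exists_sparseMinimizer H.card_pos ht H.one_lt_inc le_rfl
  rw [hxs.phiStar_eq ht.le]
  have h1 := l1_sub_le_add x xs xbar
  have h2 := (hA.level_bound H.card_pos ht le_rfl hx).2
  have h3 := hA.l1_sub_le H.card_pos ht le_rfl (hxs.goodStart ht.le hA.delta_pos.le)
  have hγ := hA.one_lt_gamma
  have hρ := hA.rho_pos'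
  have hε := (omega_nonneg A b lamTgt x).trans hω
  have h4 := (phi_sub_le A b ht.le x xs).trans
    (mul_le_mul hω (h1.trans (add_le_add h2 h3)) (l1_nonneg _) hε)
  have h5 : 0 ≤ (1 + γ) * lamTgt * ((l0 xbar : ℝ) / rhoMinus A (l0 xbar + st)) * ε := by
    positivity
  linarith

end HomotopySetup

/-- A sum of `N ≤ R` counts, each at most `B - 1`, plus one final count. -/
theorem sum_add_le_max {N k : ℕ} {s : ℕ → ℕ} {B R E : ℝ} (hs : ∀ K < N, (s K : ℝ) + 1 ≤ B)
    (hB : 0 ≤ B) (hN : (N : ℝ) ≤ R) (hE : 0 ≤ E) (hk : k = 1 ∨ (k : ℝ) + 1 ≤ E) :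
    (((∑ K ∈ Finset.range N, s K) + k : ℕ) : ℝ) ≤ max 1 (R * B + E) := by
  have hk' : (k : ℝ) ≤ 1 + E := by
    rcases hk with rfl | hk
    · simpa using hE
    · linarith
  have hsum : ((∑ K ∈ Finset.range N, s K : ℕ) : ℝ) ≤ N * (B - 1) := by
    rw [Nat.cast_sum, ← nsmul_eq_mul]
    refine (Finset.sum_le_card_nsmul _ _ (B - 1) fun K hK => ?_).trans_eq
      (by rw [Finset.card_range])
    linarith [hs K (Finset.mem_range.1 hK)]
  have hNB := mul_le_mul_of_nonneg_right hN hB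
  rw [Nat.cast_add]
  -- The final call may exceed `E` by one. A single earlier stage absorbs this through its `B - 1`;
  -- without one, either `k = 1`, which is the reason for the maximum with `1`, or `k + 1 ≤ E`.
  rcases Nat.eq_zero_or_pos N with rfl | hpos
  · have h0 : 0 ≤ R * B := by simpa using hNB
    rcases hk with rfl | hk
    · simp
    · refine le_max_of_le_right ?_
      rw [Nat.cast_zero, zero_mul] at hsum
      linarith
  · refine le_max_of_le_right ?_
    have : (1 : ℝ) ≤ N := Nat.one_le_cast.2 hpos
    linarith

end Homotopy

end PGH

theorem theorem2 {m n : ℕ} (A : Matrix (Fin m) (Fin n) ℝ) (b : Fin m → ℝ)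
    (xbar : Fin n → ℝ) (z : Fin m → ℝ)
    (lamTgt ε Lmin γinc γdec η δ γ δ' : ℝ) (st : ℕ)
    (hlamTgt : 0 < lamTgt) (hε : 0 < ε) (hLmin : 0 < Lmin)
    (hγinc : 1 < γinc) (hγdec : 1 ≤ γdec)
    (hδ : 0 < δ) (hδ1 : δ < 1)
    (hA : PGH.RecoveryAssumption A b xbar z lamTgt γ δ' st γinc Lmin)
    (hlam0 : lamTgt ≤ PGH.lam0 A b)
    (hη : (1 + δ) / (1 + δ') ≤ η) (hη1 : η < 1)
    (N : ℕ) (hN : N = PGH.numStages A b η lamTgt)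
    (sbar ρ κ C rate : ℝ)
    (hsbar : sbar = (PGH.l0 xbar : ℝ))
    (hρ : ρ = PGH.rhoMinus A (PGH.l0 xbar + st))
    (hκ : κ = PGH.kappa A (PGH.l0 xbar + 2 * st))
    (hC : C = PGH.constC γinc κ γ sbar)
    (hrate : rate = Real.log ((1 - 1 / (4 * γinc * κ))⁻¹)) :
    -- the method terminates
    (∃ (xhat : ℕ → Fin n → ℝ) (Mhat : ℕ → ℝ) (steps : ℕ → ℕ)
        (xtgt : Fin n → ℝ) (Mtgt : ℝ) (stepsTgt : ℕ),
        PGH.HomotopyRun A b γinc γdec Lmin η δ lamTgt ε xhat Mhat steps xtgt Mtgt stepsTgt) ∧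
    -- and every complete execution of it satisfies the following
    ∀ (xhat : ℕ → Fin n → ℝ) (Mhat : ℕ → ℝ) (steps : ℕ → ℕ)
      (xtgt : Fin n → ℝ) (Mtgt : ℝ) (stepsTgt : ℕ),
      PGH.HomotopyRun A b γinc γdec Lmin η δ lamTgt ε xhat Mhat steps xtgt Mtgt stepsTgt →
      -- part 1
      (((∀ K < N, PGH.GoodStart A b xbar δ' st (PGH.lamSeq A b η (K + 1)) (xhat K)) ∧
          PGH.GoodStart A b xbar δ' st lamTgt (xhat N)) ∧
        ∀ K < N, (steps K : ℝ) ≤ Real.log (C / δ ^ 2) / rate) ∧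
      -- part 2
      (∀ K < N,
        PGH.phi A b lamTgt (xhat K) - PGH.phiStar A b lamTgt
            ≤ η ^ (2 * (K + 1)) * (4.5 * (1 + γ) * PGH.lam0 A b ^ 2 * sbar / ρ) ∧
        PGH.l2 (xhat K - xbar)
            ≤ η ^ (K + 1) * (2 * PGH.lam0 A b * √sbar / ρ)) ∧
      -- part 3
      ((((∑ K ∈ Finset.range N, steps K) + stepsTgt : ℕ) : ℝ)
          ≤ max 1 ((Real.log (PGH.lam0 A b / lamTgt) / Real.log η⁻¹ * Real.log (C / δ ^ 2)
              + Real.log (max 1 (lamTgt ^ 2 * C / ε ^ 2))) / rate) ∧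
        PGH.phi A b lamTgt xtgt - PGH.phiStar A b lamTgt
            ≤ 4 * (1 + γ) * lamTgt * sbar / ρ * ε) := by
  have H : PGH.HomotopySetup A b xbar z lamTgt γ δ' st γinc γdec Lmin η δ :=
    ⟨hA, hlamTgt, hlam0, hLmin, hγinc, hγdec, hδ, hδ1, hη, hη1⟩
  refine ⟨H.exists_homotopyRun hε, fun xhat Mhat steps xtgt Mtgt stepsTgt hrun => ?_⟩
  subst hN hsbar hρ hκ hC hrate
  have hinv := fun K hK => H.stageInvariant_of_run (K := K) hrun hK
  have hgood := fun K hK => H.goodStart_succ hK (hinv K (Nat.le_of_lt hK))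
  have hfin := H.goodStart_final (hinv _ le_rfl)
  have hsteps := fun K hK => H.stage_steps_le hK (hinv K (Nat.le_of_lt hK)) (hrun.stage K hK)
  obtain ⟨xs, hxs, hout⟩ := H.proxGrad_properties le_rfl hε hfin (hinv _ le_rfl).2.1
    (hinv _ le_rfl).2.2 hrun.final
  have hη0 := H.eta_pos
  obtain ⟨hr, hr1⟩ := hA.rate_bounds hγinc
  have hrate := Real.log_pos (one_lt_inv_iff₀.2 ⟨by linarith, hr1⟩)
  have hC := hA.le_constC (γinc := γinc) H.card_pos hγinc
  refine ⟨⟨⟨hgood, hfin⟩, fun K hK => by linarith [hsteps K hK]⟩,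
    fun K hK => ⟨?_, ?_⟩, ?_, ?_⟩
  -- `xhat K` is a good start already for `lam_{K+1}`, hence the exponents with `K + 1`.
  · refine (H.phi_target_sub_le (H.le_lamSeq (K := K + 1) hK) (hgood K hK)).trans_eq ?_
    rw [PGH.lamSeq]
    ring
  · refine (hA.l2_sub_le hlamTgt (H.le_lamSeq (K := K + 1) hK) (hgood K hK)).trans_eq ?_
    rw [PGH.lamSeq]
    ring
  · have hlogη : 0 < Real.log (1 / η) := Real.log_pos (one_lt_one_div hη0 hη1)
    have hlog := Real.log_nonneg ((one_le_div hlamTgt).2 hlam0)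
    have hB : 0 ≤ Real.log (PGH.constC γinc (PGH.kappa A (PGH.l0 xbar + 2 * st)) γ
        (PGH.l0 xbar) / δ ^ 2) := by
      refine Real.log_nonneg ((one_le_div (by positivity)).2 (le_trans ?_ hC))
      exact (pow_le_one₀ hδ.le hδ1.le).trans (by norm_num)
    rw [add_div, mul_div_assoc, ← one_div η]
    refine PGH.sum_add_le_max hsteps (div_nonneg hB hrate.le)
      (Nat.floor_le (div_nonneg hlog hlogη.le))
      (div_nonneg (Real.log_nonneg (le_max_left _ _)) hrate.le) ?_
    refine (hout.steps_le hA H.card_pos hlamTgt hγinc le_rfl hε hfin hxs).imp_right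
      fun h => h.trans ?_
    refine div_le_div_of_nonneg_right (Real.log_le_log ?_ (le_max_right _ _)) hrate.le
    positivity
  · refine (H.phi_output_sub_le hout.level hout.residue).trans_eq ?_
    ring
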